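/- **Definitions.** Let $A\in\mathbb{R}^{m\times n}$ have rows $a_i^\top$ and full column rank, $1\le n\le m$, let $p\ge 4$ and $0<\varepsilon\le 1$. Put $\alpha=\frac{2}{p-2}\in(0,1]$ and $\bar\alpha=\max(\alpha,1)$; $W$ denotes $\mathrm{diag}(w)$. Write $a\approx_\varepsilon b$ for $(1-\varepsilon)a\le b\le(1+\varepsilon)a$. The $\ell_p$ Lewis weights of $A$ are the vector $v\in\mathbb{R}^m_{\ge 0}$ with $A^\top V^{1-2/p}A$ invertible and $v_i^{2/p}=a_i^\top(A^\top V^{1-2/p}A)^{-1}a_i$ for all $i$. The leverage scores of a matrix $B$ with rows $b_i^\top$ are $b_i^\top(B^\top B)^{-1}b_i$. For $w\in\mathbb{R}^m_{>0}$ let $\sigma(w)$ be the leverage scores of $W^{1/2}A$, let $\rho_i(w)=\sigma_i(w)/w_i^{1+\alpha}$, let $$\mathcal F(w)=-\log\det(A^\top WA)+\tfrac1{1+\alpha}\sum_i w_i^{1+\alpha},$$ and, for $C\subseteq[m]$, let $\mathrm{Descent}(w,C)$ be obtained from $w$ by multiplying $w_i$ by $1+\frac{1}{3\bar\alpha}\cdot\frac{\rho_i(w)-1}{\rho_i(w)+1}$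 for every $i\in C$. $\mathrm{RoundParallel}(w)$ is: while $C=\{i:\rho_i(w)>1+\alpha\}\neq\emptyset$, replace $w$ by $\mathrm{Descent}(w,C)$; return $w$. **Algorithm.** Start with $w_i=n/m$ for all $i$. Let $\tilde\varepsilon=\alpha^8\varepsilon^4/(25m(\sqrt n+\alpha)(\alpha+\alpha^{-1}))^4$ and $T=\lceil\kappa\max(\alpha^{-1},\alpha)\log(m/\tilde\varepsilon)\rceil$. Repeat $T$ times: $w\leftarrow\mathrm{RoundParallel}(w)$, then $w\leftarrow\mathrm{Descent}(w,[m])$. Finally let $w_R=\mathrm{RoundParallel}(w)$ and return $\hat w_i=(a_i^\top(A^\top W_RA)^{-1}a_i)^{1/\alpha}$. **Cost model.** Parallel programs over real registers: in a parallel step every register may receive the result of one scalar operation ($+,-,\times,/$, real power, logarithm, rational constant, selection by comparison) on the old register contents, and while loops test $x<y$. Work counts the scalar operations and loop tests, depth the parallel steps and loop tests; moving data within a step is free. Inverting a $k\times k$ matrix is a primitive charged with $k^3$ work and $(\lceil\log_2k\rceil+1)^2$ depth. There is one program for each $(m,n)$; $A$, $p$ and $\varepsilon$ are its input. **Theorem.**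 There are a constant $\kappa$ and absolute constants in the $O(\cdot)$ below such that the following holds for all $1\le n\le m$, all $A\in\mathbb{R}^{m\times n}$ of rank $n$, all $p\ge4$ and all $0<\varepsilon\le1$. 1. The Lewis weights $v$ of $A$ exist and are unique. If no row of $A$ is zero, then $\mathcal F$ has a unique minimizer $\overline w$ on $\mathbb{R}^m_{>0}$. 2. The algorithm terminates, and its output $\hat w$ satisfies $\hat w_i\approx_\varepsilon\overline w_i$ for every $i$ whenever $\overline w$ minimizes $\mathcal F$ over $\mathbb{R}^m_{>0}$. For every $A$ as above, including those with zero rows, $\hat w_i\approx_\varepsilon v_i^{1-2/p}$ and $\hat w_i^{p/(p-2)}\approx_\varepsilon v_i$ for every $i$. 3. The algorithm takes $O(p^3\log(mp/\varepsilon))$ iterations (of both loops together), each of which computes the leverage scores of $DA$ for a diagonal matrix $D$; the total number of leverage score computations, loop tests included, obeys the same bound. 4. For each $(m,n)$ there is a program that on every such input $(A,p,\varepsilon)$ computes exactly $\hat w$ and $(\hat w_i^{p/(p-2)})_i$ with total work $O(p^3mn^2\log(mp/\varepsilon))$ and, simultaneously, depth $O(p^3\log(mp/\varepsilon)\log^2(m+1))$.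 -/

import Mathlib

open Matrix

noncomputable section

namespace LewisWeights

variable {m n : ℕ}

/-! ### Leverage scores and Lewis weights -/

/-- `b ≤ (1 + ε) a` and `(1 - ε) a ≤ b`, written `a ≈_ε b`. -/
def Approx (ε a b : ℝ) : Prop := (1 - ε) * a ≤ b ∧ b ≤ (1 + ε) * a

/-- The leverage scores `bᵢᵀ (Bᵀ B)⁻¹ bᵢ` of the rows `bᵢ` of `B`. -/
def leverageScores (B : Matrix (Fin m) (Fin n) ℝ) (i : Fin m) : ℝ :=
  B i ⬝ᵥ ((Bᵀ * B)⁻¹ *ᵥ B i)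

/-- The quadratic form `aᵢᵀ (Aᵀ W A)⁻¹ aᵢ`, where `W = diag w` and `aᵢ` is the `i`-th row of `A`. -/
def rowForm (A : Matrix (Fin m) (Fin n) ℝ) (w : Fin m → ℝ) (i : Fin m) : ℝ :=
  A i ⬝ᵥ ((Aᵀ * diagonal w * A)⁻¹ *ᵥ A i)

/-- `w` is a vector of `ℓ_p` Lewis weights of `A`: `wᵢ ^ (2/p) = aᵢᵀ (Aᵀ W ^ (1 - 2/p) A)⁻¹ aᵢ`
for all `i`. The first two clauses say that the powers and the inverse are meaningful. -/
structure IsLewisWeights (A : Matrix (Fin m) (Fin n) ℝ) (p : ℝ) (w : Fin m → ℝ) : Prop where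
  nonneg : ∀ i, 0 ≤ w i
  isUnit : IsUnit (Aᵀ * diagonal (fun j => w j ^ (1 - 2 / p)) * A)
  eq : ∀ i, w i ^ (2 / p) = rowForm A (fun j => w j ^ (1 - 2 / p)) i

/-- The objective `F(w) = - log det (Aᵀ W A) + (1 + α)⁻¹ ∑ wᵢ ^ (1 + α)`. -/
def objective (A : Matrix (Fin m) (Fin n) ℝ) (α : ℝ) (w : Fin m → ℝ) : ℝ :=
  -Real.log (Aᵀ * diagonal w * A).det + 1 / (1 + α) * ∑ i, w i ^ (1 + α)

/-- `u` minimizes the objective over the positive orthant. -/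
def IsOptimal (A : Matrix (Fin m) (Fin n) ℝ) (α : ℝ) (u : Fin m → ℝ) : Prop :=
  (∀ i, 0 < u i) ∧ ∀ w : Fin m → ℝ, (∀ i, 0 < w i) → objective A α u ≤ objective A α w

/-! ### The algorithm -/

/-- The diagonal of `W ^ (1/2)`. -/
def sqrtVec (w : Fin m → ℝ) : Fin m → ℝ := fun i => √(w i)

/-- `σ(w)`: the leverage scores of `D A` for the diagonal matrix `D = W ^ (1/2)`. -/
def sigma (A : Matrix (Fin m) (Fin n) ℝ) (w : Fin m → ℝ) : Fin m → ℝ :=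
  leverageScores (diagonal (sqrtVec w) * A)

/-- `σᵢ(w) = wᵢ aᵢᵀ (Aᵀ W A)⁻¹ aᵢ`. -/
theorem sigma_eq (A : Matrix (Fin m) (Fin n) ℝ) (w : Fin m → ℝ) (hw : ∀ i, 0 ≤ w i) (i : Fin m) :
    sigma A w i = w i * rowForm A w i := by
  have hD : (diagonal (sqrtVec w) * A)ᵀ * (diagonal (sqrtVec w) * A) = Aᵀ * diagonal w * A := by
    have h : diagonal (sqrtVec w) * diagonal (sqrtVec w) = diagonal w := by
      rw [diagonal_mul_diagonal]
      congr 1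
      funext j
      exact Real.mul_self_sqrt (hw j)
    rw [transpose_mul, diagonal_transpose, Matrix.mul_assoc, ← Matrix.mul_assoc (diagonal _), h,
      ← Matrix.mul_assoc]
  have hrow : (diagonal (sqrtVec w) * A) i = √(w i) • A i := by
    funext j
    simp [sqrtVec, diagonal_mul]
  unfold sigma leverageScores rowForm
  rw [hD, hrow, mulVec_smul, smul_dotProduct, dotProduct_smul, smul_eq_mul, smul_eq_mul,
    ← mul_assoc, Real.mul_self_sqrt (hw i)]

/-- `ρᵢ(w) = σᵢ(w) / wᵢ ^ (1 + α)`. -/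
def rho (A : Matrix (Fin m) (Fin n) ℝ) (α : ℝ) (w : Fin m → ℝ) (i : Fin m) : ℝ :=
  sigma A w i / w i ^ (1 + α)

open Classical in
/-- `Descent(w, C, η)`: the coordinates in `C` are multiplied by `1 + ηᵢ (ρᵢ - 1) / (ρᵢ + 1)`, the
others are kept. -/
def descent (A : Matrix (Fin m) (Fin n) ℝ) (α : ℝ) (w : Fin m → ℝ) (C : Set (Fin m))
    (η : Fin m → ℝ) : Fin m → ℝ := fun i =>
  if i ∈ C then w i * (1 + η i * ((rho A α w i - 1) / (rho A α w i + 1))) else w i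

/-- The step sizes `1 / (3 max(α, 1))`. -/
def stepSize (m : ℕ) (α : ℝ) : Fin m → ℝ := fun _ => 1 / (3 * max α 1)

/-- The coordinates `C = {i | ρᵢ(w) > 1 + α}` violating the rounding condition. -/
def violating (A : Matrix (Fin m) (Fin n) ℝ) (α : ℝ) (w : Fin m → ℝ) : Set (Fin m) :=
  {i | rho A α w i > 1 + α}

/-- `RoundRun A α w w' L`: the `while` loop of `RoundParallel(w, A, α)` terminates and returns `w'`.
`L` is the list of all diagonals `D` for which the loop computes the leverage scores of `D A`, one
for every evaluation of the loop test (the last, failing one included); the loop body uses the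
scores computed for the test. -/
inductive RoundRun (A : Matrix (Fin m) (Fin n) ℝ) (α : ℝ) :
    (Fin m → ℝ) → (Fin m → ℝ) → List (Fin m → ℝ) → Prop
  | done (w : Fin m → ℝ) : violating A α w = ∅ → RoundRun A α w w [sqrtVec w]
  | step (w w' : Fin m → ℝ) (L : List (Fin m → ℝ)) : violating A α w ≠ ∅ →
      RoundRun A α (descent A α w (violating A α w) (stepSize m α)) w' L →
      RoundRun A α w w' (sqrtVec w :: L)

/-- `LoopRun A α T w w' L`: `T` iterations of the `for` loop of the meta-algorithm (each is a
`RoundParallel` followed by a `Descent` on all coordinates) lead from `w` to `w'`. The list `L`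
again has one entry for each computation of leverage scores. -/
inductive LoopRun (A : Matrix (Fin m) (Fin n) ℝ) (α : ℝ) :
    ℕ → (Fin m → ℝ) → (Fin m → ℝ) → List (Fin m → ℝ) → Prop
  | zero (w : Fin m → ℝ) : LoopRun A α 0 w w []
  | succ (T : ℕ) (w v w' : Fin m → ℝ) (L L' : List (Fin m → ℝ)) : RoundRun A α w v L →
      LoopRun A α T (descent A α v Set.univ (stepSize m α)) w' L' →
      LoopRun A α (T + 1) w w' (L ++ sqrtVec v :: L')

/-- `α = 2 / (p - 2)`. -/
def alpha (p : ℝ) : ℝ := 2 / (p - 2)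

/-- The target accuracy `α⁸ ε⁴ / (25 m (√n + α) (α + α⁻¹))⁴` for the objective. -/
def tildeEps (m n : ℕ) (α ε : ℝ) : ℝ :=
  α ^ 8 * ε ^ 4 / (25 * m * (√n + α) * (α + α⁻¹)) ^ 4

/-- The number `T_total` of iterations of the `for` loop, `κ` being the constant hidden in
`O(max(α⁻¹, α) log (m / tildeEps))`. -/
def totalSteps (κ : ℕ) (m n : ℕ) (p ε : ℝ) : ℕ :=
  ⌈κ * max (alpha p)⁻¹ (alpha p) * Real.log (m / tildeEps m n (alpha p) ε)⌉₊

/-- `LewisRun κ A p ε what L`: the meta-algorithm with `RoundParallel` terminates on input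
`(A, p, ε)` with output `what`, having computed the leverage scores of `D A` exactly for the
diagonals `D` in the list `L`. -/
def LewisRun (κ : ℕ) (A : Matrix (Fin m) (Fin n) ℝ) (p ε : ℝ) (what : Fin m → ℝ)
    (L : List (Fin m → ℝ)) : Prop :=
  ∃ (wT wR : Fin m → ℝ) (L₁ L₂ : List (Fin m → ℝ)),
    LoopRun A (alpha p) (totalSteps κ m n p ε) (fun _ => (n : ℝ) / m) wT L₁ ∧
    RoundRun A (alpha p) wT wR L₂ ∧
    (∀ i, what i = rowForm A wR i ^ (1 / alpha p)) ∧
    L = L₁ ++ L₂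

/-! ### The work–depth model

A program acts on finitely many real registers. In one parallel step every register may receive the
result of one scalar operation on the old contents of the registers. Work counts the operations,
depth the steps; moving data is free, as wires are in a circuit. Inversion of a `k × k` matrix is a
primitive with its customary cost: `k³` work and `(⌈log₂ k⌉ + 1)²` depth. -/

/-- Scalar instructions over registers `R`. -/
inductive Instr (R : Type)
  | copy (a : R)
  | const (q : ℚ)
  | add (a b : R)
  | sub (a b : R)
  | mul (a b : R)
  | div (a b : R)
  | pow (a b : R)
  | log (a : R)
  /-- if `a < b` then `c` else `d` -/
  | select (a b c d : R)

/-- The value of an instruction in the store `s`. -/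
def Instr.eval {R : Type} (s : R → ℝ) : Instr R → ℝ
  | .copy a => s a
  | .const q => q
  | .add a b => s a + s b
  | .sub a b => s a - s b
  | .mul a b => s a * s b
  | .div a b => s a / s b
  | .pow a b => s a ^ s b
  | .log a => Real.log (s a)
  | .select a b c d => if s a < s b then s c else s d

/-- Copies are free, all other instructions have unit cost. -/
def Instr.cost {R : Type} : Instr R → ℕ
  | .copy _ => 0
  | _ => 1

/-- Commands over registers `R`. -/
inductive Cmd (R : Type)
  /-- a parallel step: register `r` receives the value of `f r` -/
  | step (f : R → Instr R)
  /-- the matrix held by the registers `e (i, j)` is replaced by its inverse -/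
  | invert (k : ℕ) (e : Fin k × Fin k ↪ R)
  | seq (c d : Cmd R)
  /-- while `x < y` do `c` -/
  | loop (x y : R) (c : Cmd R)

/-- `Exec c s s' work depth`: the command `c`, started in the store `s`, terminates in the store
`s'` with the given work and depth. -/
inductive Exec {R : Type} [Fintype R] : Cmd R → (R → ℝ) → (R → ℝ) → ℕ → ℕ → Prop
  | step (f : R → Instr R) (s : R → ℝ) :
      Exec (.step f) s (fun r => (f r).eval s) (∑ r, (f r).cost) 1
  | invert (k : ℕ) (e : Fin k × Fin k ↪ R) (s : R → ℝ) :
      Exec (.invert k e) s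
        (Function.extend e
          (fun ij => (Matrix.of fun i j => s (e (i, j)))⁻¹ ij.1 ij.2) s)
        (k ^ 3) ((Nat.clog 2 k + 1) ^ 2)
  | seq (c d : Cmd R) (s s' s'' : R → ℝ) (w w' t t' : ℕ) :
      Exec c s s' w t → Exec d s' s'' w' t' → Exec (.seq c d) s s'' (w + w') (t + t')
  | loop_exit (x y : R) (c : Cmd R) (s : R → ℝ) :
      ¬ s x < s y → Exec (.loop x y c) s s 1 1
  | loop_enter (x y : R) (c : Cmd R) (s s' s'' : R → ℝ) (w w' t t' : ℕ) :
      s x < s y → Exec c s s' w t → Exec (.loop x y c) s' s'' w' t' →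
      Exec (.loop x y c) s s'' (1 + w + w') (1 + t + t')

/-- A program with real inputs indexed by `I` and real outputs indexed by `O`. Its registers are the
input registers and finitely many scratch registers. -/
structure Program (I O : Type) where
  Scratch : Type
  [fintype : Fintype Scratch]
  body : Cmd (I ⊕ Scratch)
  out : O → I ⊕ Scratch

attribute [instance] Program.fintype

/-- `P.Computes x y work depth`: on input `x` the program `P` halts with output `y`, with the given
work and depth. Scratch registers are initially zero. -/
def Program.Computes {I O : Type} [Fintype I] (P : Program I O) (x : I → ℝ) (y : O → ℝ)
    (work depth : ℕ) : Prop :=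
  ∃ s : I ⊕ P.Scratch → ℝ, Exec P.body (Sum.elim x 0) s work depth ∧ ∀ o, y o = s (P.out o)

/-- The input registers of a Lewis weight program: the entries of `A`, then `p` and `ε`. -/
abbrev Input (m n : ℕ) : Type := (Fin m × Fin n) ⊕ Fin 2

/-- The input `(A, p, ε)` as contents of the input registers. -/
def encode (A : Matrix (Fin m) (Fin n) ℝ) (p ε : ℝ) : Input m n → ℝ :=
  Sum.elim (fun ij => A ij.1 ij.2) ![p, ε]

end LewisWeights

end

noncomputable section

namespace LewisWeights

/-! ### Linear algebra: log-determinants, weighted Gram matrices and their quadratic forms. -/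

section

variable {m n : ℕ}

/-! ### Pairs of positive definite matrices -/

/-! Everything passes through the fixed-point equation `uᵢ ^ α = aᵢᵀ (Aᵀ U A)⁻¹ aᵢ`, `u ≥ 0`. It is
the first-order condition of the objective `F`, and the substitution `v = u ^ (1 + α)` turns it into
the Lewis weight equation, since `(1 - 2/p)(1 + α) = 1`. A solution exists by compactness, even with
zero rows, where `uᵢ = 0` (`exists_isFixedPoint`). The gap `F(w) - F(u)` dominates the
log-determinant divergence of `Aᵀ W A` from `Aᵀ U A`, so a gap of at most `τ²` makes the quadratic
forms at `w` and `u` agree up to factors `(1 ± τ)²` (`IsFixedPoint.rowForm_approx`). With `τ = 0`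
this is uniqueness; with `τ = αε/12` it is the accuracy of the output.

A descent step on `C` lowers `F` by at least a sixth of the residuals `wᵢ ^ (1 + α) (ρᵢ - 1)² / (ρᵢ
+ 1)` summed over `C` (`objective_descent_le`): a Jensen inequality for matrix inverses decouples
the coordinates. At a rounded point, where every `ρᵢ ≤ 1 + α`, the gap is conversely at most
`9/(2α)` times the sum of all residuals (`IsFixedPoint.gap_le`). Hence a full step from a rounded
point contracts the gap by `1 - α/27`. The initial gap is at most `m`, so `T = O(α⁻¹ log (m /
tildeEps))` full steps suffice.

Rounding never raises the objective. It only increases weights, so all quadratic forms decrease, and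
each violating `ρᵢ` falls by the factor `(1 + α/9) ^ α`, whose logarithm is at least `α²/10`.
Starting from `ρ ≤ R` it therefore takes `O(α⁻² log R)` tests, where `R` is of order `m²` the first
time and `5` after each full step. Summing up and using `α⁻¹ ≤ p` gives `O(p³ log (mp/ε))` leverage
score computations.

The program mirrors this run. One evaluation of the quadratic forms consists of entrywise products,
binary-tree sums and one inversion, with work `O(mn²)` and depth `O(log² (m + 1))`; the cost bounds
follow by induction on the run (`roundLoop_within`, `mainLoopCmd_within`). -/

theorem exists_simultaneous_diagonalization {X Y : Matrix (Fin n) (Fin n) ℝ} (hX : X.PosDef)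
    (hY : Y.PosDef) : ∃ (S : Matrix (Fin n) (Fin n) ℝ) (l : Fin n → ℝ), Sᵀ * Y * S = 1 ∧
      Sᵀ * X * S = diagonal l ∧ ∀ k, 0 < l k := by
  open scoped MatrixOrder in
  obtain ⟨B, hB⟩ := CStarAlgebra.nonneg_iff_eq_star_mul_self.mp hY.posSemidef.nonneg
  rw [star_eq_conjTranspose, conjTranspose_eq_transpose_of_trivial] at hB
  have hBu : IsUnit B.det := by
    have h : Y.det ≠ 0 := hY.det_pos.ne'
    rw [hB, det_mul] at h
    exact (right_ne_zero_of_mul h).isUnit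
  -- Congruence by `B⁻¹` turns `Y = Bᵀ B` into the identity and `X` into `Z`; an orthogonal
  -- diagonalization of `Z` leaves the identity alone.
  have hZ : (B⁻¹ᵀ * X * B⁻¹).PosDef := by
    have := hX.conjTranspose_mul_mul_same (B := B⁻¹) (by
      rw [mulVec_injective_iff_isUnit]
      exact (isUnit_iff_isUnit_det _).2 ((isUnit_nonsing_inv_det_iff).2 hBu))
    rwa [conjTranspose_eq_transpose_of_trivial] at this
  set Z := B⁻¹ᵀ * X * B⁻¹ with hZdef
  set U : Matrix (Fin n) (Fin n) ℝ := (hZ.1.eigenvectorUnitary : Matrix (Fin n) (Fin n) ℝ)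
  have hU : Uᵀ * U = 1 := by
    have := (Unitary.mem_iff.1 hZ.1.eigenvectorUnitary.2).1
    rwa [star_eq_conjTranspose, conjTranspose_eq_transpose_of_trivial] at this
  have hD : Z = U * diagonal hZ.1.eigenvalues * Uᵀ := by
    have := hZ.1.spectral_theorem
    rw [Unitary.conjStarAlgAut_apply, star_eq_conjTranspose,
      conjTranspose_eq_transpose_of_trivial] at this
    exact this
  refine ⟨B⁻¹ * U, hZ.1.eigenvalues, ?_, ?_, hZ.eigenvalues_pos⟩
  · have h1 : B⁻¹ᵀ * Bᵀ = 1 := by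
      rw [← transpose_mul, mul_nonsing_inv _ hBu, transpose_one]
    calc (B⁻¹ * U)ᵀ * Y * (B⁻¹ * U) = Uᵀ * (B⁻¹ᵀ * Bᵀ) * (B * B⁻¹) * U := by
          rw [hB, transpose_mul]; simp only [Matrix.mul_assoc]
      _ = 1 := by rw [h1, mul_nonsing_inv _ hBu, Matrix.mul_one, Matrix.mul_one, hU]
  · calc (B⁻¹ * U)ᵀ * X * (B⁻¹ * U) = Uᵀ * Z * U := by
          rw [hZdef, transpose_mul]; simp only [Matrix.mul_assoc]
      _ = Uᵀ * (U * diagonal hZ.1.eigenvalues * Uᵀ) * U := congrArg (fun N => Uᵀ * N * U) hD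
      _ = (Uᵀ * U) * diagonal hZ.1.eigenvalues * (Uᵀ * U) := by simp only [Matrix.mul_assoc]
      _ = _ := by rw [hU, Matrix.one_mul, Matrix.mul_one]

/-- The consequences of a simultaneous diagonalization for traces, determinants and inverses. -/
theorem exists_relative_eigenvalues {X Y : Matrix (Fin n) (Fin n) ℝ} (hX : X.PosDef)
    (hY : Y.PosDef) : ∃ (S : Matrix (Fin n) (Fin n) ℝ) (l : Fin n → ℝ), (∀ k, 0 < l k) ∧
      (Y⁻¹ * X).trace = ∑ k, l k ∧ Real.log X.det - Real.log Y.det = ∑ k, Real.log (l k) ∧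
      (∀ x, x ⬝ᵥ (Y⁻¹ *ᵥ x) = ∑ k, (Sᵀ *ᵥ x) k ^ 2) ∧
      (∀ x, x ⬝ᵥ (X⁻¹ *ᵥ x) = ∑ k, (l k)⁻¹ * (Sᵀ *ᵥ x) k ^ 2) := by
  obtain ⟨S, l, hS, hl, hpos⟩ := exists_simultaneous_diagonalization hX hY
  have hdet := congrArg det hS
  simp only [det_mul, det_transpose, det_one] at hdet
  have hSd : S.det ≠ 0 := fun h => by simp [h] at hdet
  have hSu : IsUnit S.det := hSd.isUnit
  have hSt : IsUnit Sᵀ.det := by rwa [det_transpose]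
  have hinv : ∀ (Z D : Matrix (Fin n) (Fin n) ℝ), IsUnit D.det → Sᵀ * Z * S = D →
      Z⁻¹ = S * D⁻¹ * Sᵀ := by
    intro Z D hD h
    refine inv_eq_right_inv ?_
    have hZ : Z = Sᵀ⁻¹ * D * S⁻¹ := by
      rw [← h, Matrix.mul_assoc Sᵀ, nonsing_inv_mul_cancel_left _ _ hSt,
        mul_nonsing_inv_cancel_right _ _ hSu]
    rw [hZ, Matrix.mul_assoc, Matrix.mul_assoc S, nonsing_inv_mul_cancel_left _ _ hSu,
      ← Matrix.mul_assoc, mul_assoc (Sᵀ⁻¹), mul_nonsing_inv _ hD, Matrix.mul_one,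
      nonsing_inv_mul _ hSt]
  have hYi : Y⁻¹ = S * Sᵀ := by
    have := hinv Y 1 (by simp) hS
    rwa [inv_one, Matrix.mul_one] at this
  have hXi : X⁻¹ = S * diagonal (fun k => (l k)⁻¹) * Sᵀ := by
    have hu : IsUnit (diagonal l).det := by
      rw [det_diagonal]; exact (Finset.prod_pos fun k _ => hpos k).ne'.isUnit
    have := hinv X _ hu hl
    rw [this]
    congr 2
    refine inv_eq_right_inv ?_
    rw [diagonal_mul_diagonal, ← diagonal_one]
    congr 1
    funext k
    exact mul_inv_cancel₀ (hpos k).ne'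
  refine ⟨S, l, hpos, ?_, ?_, fun x => ?_, fun x => ?_⟩
  · rw [hYi, Matrix.mul_assoc, trace_mul_comm, hl, trace_diagonal]
  · have h2 := congrArg det hl
    simp only [det_mul, det_transpose, det_diagonal] at h2
    rw [← Real.log_div hX.det_pos.ne' hY.det_pos.ne', ← Real.log_prod (fun k _ => (hpos k).ne')]
    congr 1
    rw [← h2]
    field_simp [hY.det_pos.ne']
    linear_combination (-X.det) * hdet
  · rw [hYi, ← mulVec_mulVec, dotProduct_mulVec, ← mulVec_transpose]
    simp [dotProduct, sq]
  · rw [hXi, ← mulVec_mulVec, ← mulVec_mulVec, dotProduct_mulVec, ← mulVec_transpose]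
    simp only [dotProduct, mulVec_diagonal]
    exact Finset.sum_congr rfl fun k _ => by ring

/-- Concavity of log det, which reduces to `log t ≤ t - 1` at each relative eigenvalue. -/
theorem log_det_sub_le {X Y : Matrix (Fin n) (Fin n) ℝ} (hX : X.PosDef) (hY : Y.PosDef) :
    Real.log X.det - Real.log Y.det ≤ (Y⁻¹ * X).trace - n := by
  obtain ⟨S, l, hl, htr, hdet, -⟩ := exists_relative_eigenvalues hX hY
  rw [htr, hdet]
  have : (n : ℝ) = ∑ _k : Fin n, (1 : ℝ) := by simp
  rw [this, ← Finset.sum_sub_distrib]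
  exact Finset.sum_le_sum fun k _ => Real.log_le_sub_one_of_pos (hl k)

/-- Matrices whose log-determinant divergence is small have nearly equal inverses. -/
theorem quadraticForm_inv_approx {X Y : Matrix (Fin n) (Fin n) ℝ} (hX : X.PosDef) (hY : Y.PosDef)
    {τ : ℝ} (h0 : 0 ≤ τ) (h1 : τ ≤ 1)
    (h : (Y⁻¹ * X).trace - n - (Real.log X.det - Real.log Y.det) ≤ τ ^ 2) (x : Fin n → ℝ) :
    (1 - τ) ^ 2 * (x ⬝ᵥ (X⁻¹ *ᵥ x)) ≤ x ⬝ᵥ (Y⁻¹ *ᵥ x) ∧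
      x ⬝ᵥ (Y⁻¹ *ᵥ x) ≤ (1 + τ) ^ 2 * (x ⬝ᵥ (X⁻¹ *ᵥ x)) := by
  obtain ⟨S, l, hl, htr, hdet, hy, hx⟩ := exists_relative_eigenvalues hX hY
  rw [htr, hdet] at h
  have hn : (n : ℝ) = ∑ _k : Fin n, (1 : ℝ) := by simp
  rw [hn, ← Finset.sum_sub_distrib, ← Finset.sum_sub_distrib] at h
  -- This is `log √l ≤ √l - 1`, doubled. All summands of the divergence are thus nonnegative, so
  -- each one alone is at most `τ²` and `|√l - 1| ≤ τ`.
  have hsq : ∀ k, (√(l k) - 1) ^ 2 ≤ l k - 1 - Real.log (l k) := by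
    intro k
    have h1 := Real.log_le_sub_one_of_pos (Real.sqrt_pos.2 (hl k))
    rw [Real.log_sqrt (hl k).le] at h1
    have h2 := Real.sq_sqrt (hl k).le
    nlinarith
  have hk : ∀ k, (1 - τ) ^ 2 ≤ l k ∧ l k ≤ (1 + τ) ^ 2 := by
    intro k
    have h2 : l k - 1 - Real.log (l k) ≤ τ ^ 2 :=
      (Finset.single_le_sum (f := fun k => l k - 1 - Real.log (l k))
        (fun k _ => (sq_nonneg _).trans (hsq k)) (Finset.mem_univ k)).trans h
    have h3 := abs_le.1 (abs_le_of_sq_le_sq ((hsq k).trans h2) h0)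
    have h4 := Real.sq_sqrt (hl k).le
    have h5 := Real.sqrt_nonneg (l k)
    constructor <;> nlinarith [h3.1, h3.2]
  rw [hy, hx, Finset.mul_sum, Finset.mul_sum]
  refine ⟨Finset.sum_le_sum fun k _ => ?_, Finset.sum_le_sum fun k _ => ?_⟩
  · rw [← mul_assoc]
    refine mul_le_of_le_one_left (sq_nonneg _) ?_
    rw [← div_eq_mul_inv, div_le_one (hl k)]
    exact (hk k).1
  · rw [← mul_assoc]
    refine le_mul_of_one_le_left (sq_nonneg _) ?_
    rw [← div_eq_mul_inv, one_le_div (hl k)]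
    exact (hk k).2

/-! ### Weighted Gram matrices -/

/-- `Aᵀ W A`. -/
def gram (A : Matrix (Fin m) (Fin n) ℝ) (w : Fin m → ℝ) : Matrix (Fin n) (Fin n) ℝ :=
  Aᵀ * diagonal w * A

variable {A : Matrix (Fin m) (Fin n) ℝ} {w w' : Fin m → ℝ}

theorem gram_apply (A : Matrix (Fin m) (Fin n) ℝ) (w : Fin m → ℝ) (j k : Fin n) :
    gram A w j k = ∑ i, A i j * w i * A i k := by
  simp [gram, mul_apply, diagonal_apply]

theorem gram_transpose (A : Matrix (Fin m) (Fin n) ℝ) (w : Fin m → ℝ) :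
    (gram A w)ᵀ = gram A w := by
  ext j k
  simp only [transpose_apply, gram_apply]
  exact Finset.sum_congr rfl fun i _ => by ring

theorem gram_inv_transpose (A : Matrix (Fin m) (Fin n) ℝ) (w : Fin m → ℝ) :
    (gram A w)⁻¹ᵀ = (gram A w)⁻¹ := by
  rw [transpose_nonsing_inv, gram_transpose]

theorem dotProduct_gram_mulVec (A : Matrix (Fin m) (Fin n) ℝ) (w : Fin m → ℝ) (y z : Fin n → ℝ) :
    y ⬝ᵥ (gram A w *ᵥ z) = ∑ i, w i * (A i ⬝ᵥ y) * (A i ⬝ᵥ z) := by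
  have : gram A w *ᵥ z = Aᵀ *ᵥ (diagonal w *ᵥ (A *ᵥ z)) := by
    rw [gram, ← mulVec_mulVec, ← mulVec_mulVec]
  rw [this, dotProduct_mulVec, vecMul_transpose]
  refine Finset.sum_congr rfl fun i _ => ?_
  rw [mulVec_diagonal]
  change (A i ⬝ᵥ y) * (w i * (A i ⬝ᵥ z)) = _
  ring

theorem trace_mul_gram (A : Matrix (Fin m) (Fin n) ℝ) (w : Fin m → ℝ)
    (N : Matrix (Fin n) (Fin n) ℝ) : (N * gram A w).trace = ∑ i, w i * (A i ⬝ᵥ (N *ᵥ A i)) := by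
  rw [gram, ← Matrix.mul_assoc, trace_mul_comm, ← Matrix.mul_assoc, ← Matrix.mul_assoc, trace]
  refine Finset.sum_congr rfl fun i _ => ?_
  rw [diag_apply, mul_diagonal, mul_comm]
  congr 1
  rw [Matrix.mul_assoc, mul_apply, dotProduct]
  refine Finset.sum_congr rfl fun j _ => ?_
  rfl

theorem gram_posSemidef (A : Matrix (Fin m) (Fin n) ℝ) (hw : ∀ i, 0 ≤ w i) :
    (gram A w).PosSemidef := by
  refine PosSemidef.of_dotProduct_mulVec_nonneg ?_ fun x => ?_
  · rw [IsHermitian, conjTranspose_eq_transpose_of_trivial, gram_transpose]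
  · rw [star_trivial, dotProduct_gram_mulVec]
    exact Finset.sum_nonneg fun i _ => by
      rw [mul_assoc]; exact mul_nonneg (hw i) (mul_self_nonneg _)

theorem gram_posDef_of_isUnit (hw : ∀ i, 0 ≤ w i) (h : IsUnit (gram A w)) :
    (gram A w).PosDef := by
  open scoped MatrixOrder in
  exact ((gram_posSemidef A hw).posDef_iff_isUnit).2 h

theorem mulVec_ne_zero_of_rank (hA : A.rank = n) {x : Fin n → ℝ} (hx : x ≠ 0) :
    ∃ i, A i ⬝ᵥ x ≠ 0 := by
  have hli : LinearIndependent ℝ A.col := by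
    rw [linearIndependent_iff_card_eq_finrank_span, Fintype.card_fin]
    exact hA.symm.trans (rank_eq_finrank_span_cols A)
  have hinj := mulVec_injective_iff.2 hli
  by_contra! hc
  exact hx (hinj (by rw [mulVec_zero]; funext i; exact hc i))

theorem gram_posDef (hA : A.rank = n) (hw : ∀ i, 0 < w i) : (gram A w).PosDef := by
  refine PosDef.of_dotProduct_mulVec_pos (gram_posSemidef A fun i => (hw i).le).1 fun x hx => ?_
  rw [star_trivial, dotProduct_gram_mulVec]
  obtain ⟨i, hi⟩ := mulVec_ne_zero_of_rank hA hx
  refine Finset.sum_pos' (fun i _ => by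
      rw [mul_assoc]; exact mul_nonneg (hw i).le (mul_self_nonneg _)) ⟨i, Finset.mem_univ i, ?_⟩
  rw [mul_assoc]
  exact mul_pos (hw i) (mul_self_pos.2 hi)

/-! ### The quadratic forms `aᵢᵀ (Aᵀ W A)⁻¹ aᵢ` -/

theorem rowForm_eq (A : Matrix (Fin m) (Fin n) ℝ) (w : Fin m → ℝ) (i : Fin m) :
    rowForm A w i = A i ⬝ᵥ ((gram A w)⁻¹ *ᵥ A i) := rfl

theorem rowForm_nonneg (A : Matrix (Fin m) (Fin n) ℝ) (hw : ∀ i, 0 ≤ w i) (i : Fin m) :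
    0 ≤ rowForm A w i := by
  have := (gram_posSemidef A hw).inv.dotProduct_mulVec_nonneg (A i)
  rwa [star_trivial] at this

theorem rowForm_pos (h : (gram A w).PosDef) {i : Fin m} (hi : A i ≠ 0) : 0 < rowForm A w i := by
  have := h.inv.dotProduct_mulVec_pos hi
  rwa [star_trivial] at this

theorem trace_inv_mul_gram (A : Matrix (Fin m) (Fin n) ℝ) (w w' : Fin m → ℝ) :
    ((gram A w)⁻¹ * gram A w').trace = ∑ i, w' i * rowForm A w i :=
  trace_mul_gram A w' _

theorem sum_mul_rowForm (h : (gram A w).PosDef) : ∑ i, w i * rowForm A w i = n := by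
  rw [← trace_inv_mul_gram, nonsing_inv_mul _ h.det_pos.ne'.isUnit, trace_one, Fintype.card_fin]

theorem gram_inv_quadraticForm (h : (gram A w).PosDef) (x : Fin n → ℝ) :
    x ⬝ᵥ ((gram A w)⁻¹ *ᵥ x) = ∑ i, w i * (A i ⬝ᵥ ((gram A w)⁻¹ *ᵥ x)) ^ 2 := by
  have h1 := dotProduct_gram_mulVec A w ((gram A w)⁻¹ *ᵥ x) ((gram A w)⁻¹ *ᵥ x)
  rw [mulVec_mulVec, mul_nonsing_inv _ h.det_pos.ne'.isUnit, one_mulVec, dotProduct_comm] at h1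
  rw [h1]
  exact Finset.sum_congr rfl fun i _ => by ring

/-- Expanding `aᵢᵀ M⁻¹ aᵢ` as a weighted sum of squares, the term of index `i` is `wᵢ (aᵢᵀ M⁻¹
aᵢ)²`, and the other terms are nonnegative. -/
theorem mul_rowForm_le_one (h : (gram A w).PosDef) (hw : ∀ i, 0 ≤ w i) (i : Fin m) :
    w i * rowForm A w i ≤ 1 := by
  have h1 := gram_inv_quadraticForm h (A i)
  have h2 : w i * rowForm A w i ^ 2 ≤ rowForm A w i := by
    conv_rhs => rw [rowForm_eq, h1]
    exact Finset.single_le_sum (f := fun j => w j * (A j ⬝ᵥ ((gram A w)⁻¹ *ᵥ A i)) ^ 2)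
      (fun j _ => mul_nonneg (hw j) (sq_nonneg _)) (Finset.mem_univ i)
  have h3 := rowForm_nonneg A hw i
  by_contra! hc
  have h4 : 0 < rowForm A w i := by
    rcases h3.lt_or_eq with h | h
    · exact h
    · rw [← h] at hc; simp at hc; linarith
  nlinarith

/-- A Jensen inequality for the inverse of `Aᵀ W D A` in terms of `D`. -/
theorem quadraticForm_inv_gram_le (h : (gram A w).PosDef) (hw : ∀ i, 0 ≤ w i) {d : Fin m → ℝ}
    (hd : ∀ i, 0 < d i) (h' : (gram A fun i => d i * w i).PosDef) (x : Fin n → ℝ) :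
    x ⬝ᵥ ((gram A fun i => d i * w i)⁻¹ *ᵥ x) ≤
      ∑ i, w i / d i * (A i ⬝ᵥ ((gram A w)⁻¹ *ᵥ x)) ^ 2 := by
  set M := gram A fun i => d i * w i
  have h1 : (M⁻¹ *ᵥ x) ⬝ᵥ x = ∑ i, w i * (A i ⬝ᵥ (M⁻¹ *ᵥ x)) * (A i ⬝ᵥ ((gram A w)⁻¹ *ᵥ x)) := by
    rw [← dotProduct_gram_mulVec, mulVec_mulVec, mul_nonsing_inv _ h.det_pos.ne'.isUnit,
      one_mulVec]
  have h2 := gram_inv_quadraticForm h' x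
  -- AM-GM in each coordinate, `2ab ≤ d a² + b² / d`; the sum of the terms `d w a²` is again `xᵀ M⁻¹
  -- x`.
  have h3 : 2 * (x ⬝ᵥ (M⁻¹ *ᵥ x)) ≤ x ⬝ᵥ (M⁻¹ *ᵥ x) +
      ∑ i, w i / d i * (A i ⬝ᵥ ((gram A w)⁻¹ *ᵥ x)) ^ 2 := by
    conv_lhs => rw [dotProduct_comm, h1]
    conv_rhs => rw [h2]
    rw [Finset.mul_sum, ← Finset.sum_add_distrib]
    refine Finset.sum_le_sum fun i _ => ?_
    have hdi := hd i
    set a := A i ⬝ᵥ (M⁻¹ *ᵥ x)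
    set b := A i ⬝ᵥ ((gram A w)⁻¹ *ᵥ x)
    have : d i * w i * a ^ 2 + w i / d i * b ^ 2 - 2 * (w i * a * b) =
        w i / d i * (d i * a - b) ^ 2 := by
      field_simp
      ring
    have h4 : 0 ≤ w i / d i * (d i * a - b) ^ 2 :=
      mul_nonneg (div_nonneg (hw i) hdi.le) (sq_nonneg _)
    linarith
  linarith

/-- The left side is the trace of `(Aᵀ D W A)⁻¹ (Aᵀ W A)`, which bounds the change of `-log det`
under scaling by `d`. Applying the Jensen inequality to every row and exchanging the sums replaces
it by a sum in which the `dᵢ` are decoupled. -/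
theorem sum_mul_rowForm_le (h : (gram A w).PosDef) (hw : ∀ i, 0 ≤ w i) {d : Fin m → ℝ}
    (hd : ∀ i, 0 < d i) (h' : (gram A fun i => d i * w i).PosDef) :
    ∑ i, w i * rowForm A (fun i => d i * w i) i ≤ ∑ i, w i * rowForm A w i / d i := by
  calc ∑ i, w i * rowForm A (fun i => d i * w i) i
      ≤ ∑ j, w j * ∑ i, w i / d i * (A i ⬝ᵥ ((gram A w)⁻¹ *ᵥ A j)) ^ 2 :=
        Finset.sum_le_sum fun j _ =>
          mul_le_mul_of_nonneg_left (quadraticForm_inv_gram_le h hw hd h' (A j)) (hw j)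
    _ = ∑ i, w i / d i * ∑ j, w j * (A j ⬝ᵥ ((gram A w)⁻¹ *ᵥ A i)) ^ 2 := by
        simp only [Finset.mul_sum]
        rw [Finset.sum_comm]
        refine Finset.sum_congr rfl fun i _ => Finset.sum_congr rfl fun j _ => ?_
        have : A i ⬝ᵥ ((gram A w)⁻¹ *ᵥ A j) = A j ⬝ᵥ ((gram A w)⁻¹ *ᵥ A i) := by
          rw [dotProduct_mulVec, ← mulVec_transpose, gram_inv_transpose, dotProduct_comm]
        rw [this]
        ring
    _ = _ := by
        refine Finset.sum_congr rfl fun i _ => ?_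
        rw [← gram_inv_quadraticForm h (A i), ← rowForm_eq]
        ring

/-- Antitonicity of the inverse, read off the Jensen inequality with `d = w' / w ≥ c`. -/
theorem rowForm_le_of_le (hA : A.rank = n) (hw : ∀ i, 0 < w i) {c : ℝ} (hc : 0 < c)
    (hle : ∀ i, c * w i ≤ w' i) (i : Fin m) : rowForm A w' i ≤ c⁻¹ * rowForm A w i := by
  have h := gram_posDef hA hw
  have hw' : ∀ i, 0 < w' i := fun i => (mul_pos hc (hw i)).trans_le (hle i)
  have he : (fun i => w' i / w i * w i) = w' := funext fun i => div_mul_cancel₀ _ (hw i).ne'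
  have h1 := quadraticForm_inv_gram_le (d := fun i => w' i / w i) h (fun i => (hw i).le)
    (fun i => div_pos (hw' i) (hw i)) (by rw [he]; exact gram_posDef hA hw') (A i)
  rw [he] at h1
  refine h1.trans ?_
  rw [rowForm_eq, gram_inv_quadraticForm h, Finset.mul_sum]
  refine Finset.sum_le_sum fun j _ => ?_
  rw [← mul_assoc]
  refine mul_le_mul_of_nonneg_right ?_ (sq_nonneg _)
  rw [div_div_eq_mul_div, inv_mul_eq_div, div_le_div_iff₀ (hw' j) hc]
  nlinarith [hle j, hw j]

theorem gram_update (A : Matrix (Fin m) (Fin n) ℝ) (w : Fin m → ℝ) (i : Fin m) (t : ℝ) :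
    gram A (Function.update w i (w i + t)) = gram A w +
      replicateCol Unit (t • A i) * replicateRow Unit (A i) := by
  ext j k
  rw [Matrix.add_apply, gram_apply, gram_apply, mul_apply]
  simp only [Finset.univ_unique, Finset.sum_singleton, replicateCol_apply, replicateRow_apply,
    Pi.smul_apply, smul_eq_mul]
  rw [← Finset.add_sum_erase _ _ (Finset.mem_univ i), ← Finset.add_sum_erase _ _
    (Finset.mem_univ i), Function.update_self, Finset.sum_congr rfl (fun l hl => by
      rw [Function.update_of_ne (Finset.ne_of_mem_erase hl)])]
  ring

/-- The matrix determinant lemma: changing one weight is a rank-one update. -/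
theorem det_gram_update (h : (gram A w).PosDef) (i : Fin m) (t : ℝ) :
    (gram A (Function.update w i (w i + t))).det = (gram A w).det * (1 + t * rowForm A w i) := by
  rw [gram_update, det_add_replicateCol_mul_replicateRow h.det_pos.ne'.isUnit,
    det_unique (n := Unit)]
  congr 1
  rw [Matrix.add_apply, one_apply_eq, Matrix.mul_assoc, mul_apply]
  congr 1
  rw [rowForm_eq, dotProduct, Finset.mul_sum]
  refine Finset.sum_congr rfl fun j _ => ?_
  rw [replicateRow_apply, mul_apply]
  simp only [replicateCol_apply, Pi.smul_apply, smul_eq_mul, mulVec, dotProduct, Finset.mul_sum]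
  exact Finset.sum_congr rfl fun k _ => by ring

end

/-! ### The objective, its fixed points, and their equivalence with Lewis weights. -/

section

variable {m n : ℕ} {A : Matrix (Fin m) (Fin n) ℝ} {w : Fin m → ℝ} {α : ℝ}

open Filter Topology

/-! ### Fixed points and the objective -/

/-- The vectors `u ≥ 0` with `uᵢ ^ α = aᵢᵀ (Aᵀ U A)⁻¹ aᵢ`; they are the powers `v ^ (1 - 2/p)` of
Lewis weights. -/
structure IsFixedPoint (A : Matrix (Fin m) (Fin n) ℝ) (α : ℝ) (u : Fin m → ℝ) : Prop where
  nonneg : ∀ i, 0 ≤ u i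
  posDef : (gram A u).PosDef
  eq : ∀ i, u i ^ α = rowForm A u i

theorem objective_eq (A : Matrix (Fin m) (Fin n) ℝ) (α : ℝ) (w : Fin m → ℝ) :
    objective A α w = -Real.log (gram A w).det + 1 / (1 + α) * ∑ i, w i ^ (1 + α) := rfl

theorem objective_sub (A : Matrix (Fin m) (Fin n) ℝ) (α : ℝ) (w u : Fin m → ℝ) :
    objective A α w - objective A α u = -(Real.log (gram A w).det - Real.log (gram A u).det) +
      ∑ i, (w i ^ (1 + α) - u i ^ (1 + α)) / (1 + α) := by
  rw [objective_eq, objective_eq, ← Finset.sum_div, Finset.sum_sub_distrib]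
  ring

/-- Young's inequality for the conjugate exponents `1 + α` and `(1 + α) / α`. -/
theorem mul_le_rpow_one_add (hα : 0 < α) {a x : ℝ} (ha : 0 ≤ a) (hx : 0 ≤ x) :
    a * x ≤ x ^ (1 + α) / (1 + α) + α / (1 + α) * a ^ ((1 + α) / α) := by
  have hpq : (1 + α).HolderConjugate ((1 + α) / α) := by
    rw [Real.holderConjugate_iff]
    refine ⟨by linarith, ?_⟩
    field_simp
  have h := Real.young_inequality_of_nonneg hx ha hpq
  rw [mul_comm a x]
  refine h.trans_eq ?_
  congr 1
  field_simp

theorem rpow_one_add_eq (hα : 0 < α) {x : ℝ} (hx : 0 ≤ x) : x ^ (1 + α) = x ^ α * x := by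
  rw [add_comm, Real.rpow_add_one' hx (by linarith)]

/-- Convexity of `x ^ (1 + α) / (1 + α)`, as Young's inequality with `a = u ^ α`. This form also
covers `u = 0`. -/
theorem bregman_nonneg (hα : 0 < α) {u x : ℝ} (hu : 0 ≤ u) (hx : 0 ≤ x) :
    0 ≤ (x ^ (1 + α) - u ^ (1 + α)) / (1 + α) - u ^ α * (x - u) := by
  have h := mul_le_rpow_one_add hα (Real.rpow_nonneg hu α) hx
  rw [← Real.rpow_mul hu, mul_div_cancel₀ _ hα.ne'] at h
  have h2 := rpow_one_add_eq hα hu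
  have h3 : α / (1 + α) * u ^ (1 + α) = u ^ (1 + α) - u ^ (1 + α) / (1 + α) := by
    field_simp
    ring
  rw [h3] at h
  rw [sub_div, mul_sub, ← h2]
  linarith

theorem IsFixedPoint.sum_eq {u : Fin m → ℝ} (h : IsFixedPoint A α u) :
    ∑ i, u i * u i ^ α = n := by
  rw [← sum_mul_rowForm h.posDef]
  exact Finset.sum_congr rfl fun i _ => by rw [h.eq]

/-- At a fixed point, the gap of the objective dominates a log-determinant divergence. -/
theorem IsFixedPoint.divergence_le {u : Fin m → ℝ} (h : IsFixedPoint A α u) (hα : 0 < α)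
    (hw : ∀ i, 0 ≤ w i) :
    ((gram A u)⁻¹ * gram A w).trace - n - (Real.log (gram A w).det - Real.log (gram A u).det) ≤
      objective A α w - objective A α u := by
  rw [objective_sub, trace_inv_mul_gram, ← h.sum_eq, ← Finset.sum_sub_distrib]
  -- By the fixed-point equation the trace minus `n` is the linear part at `u` of the power sum, so
  -- only the convexity of the powers is needed.
  have : ∑ i, (w i * rowForm A u i - u i * u i ^ α) ≤
      ∑ i, (w i ^ (1 + α) - u i ^ (1 + α)) / (1 + α) := by
    refine Finset.sum_le_sum fun i _ => ?_
    have := bregman_nonneg hα (h.nonneg i) (hw i)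
    rw [← h.eq]
    linarith
  linarith

theorem IsFixedPoint.objective_le {u : Fin m → ℝ} (h : IsFixedPoint A α u) (hα : 0 < α)
    (hw : ∀ i, 0 ≤ w i) (hpd : (gram A w).PosDef) : objective A α u ≤ objective A α w := by
  have h1 := h.divergence_le hα hw
  have h2 := log_det_sub_le hpd h.posDef
  linarith

/-- A weight vector of small objective has nearly optimal quadratic forms. -/
theorem IsFixedPoint.rowForm_approx {u : Fin m → ℝ} (h : IsFixedPoint A α u) (hα : 0 < α)
    (hw : ∀ i, 0 ≤ w i) (hpd : (gram A w).PosDef) {τ : ℝ} (h0 : 0 ≤ τ) (h1 : τ ≤ 1)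
    (hg : objective A α w - objective A α u ≤ τ ^ 2) (i : Fin m) :
    (1 - τ) ^ 2 * rowForm A w i ≤ u i ^ α ∧ u i ^ α ≤ (1 + τ) ^ 2 * rowForm A w i := by
  rw [h.eq]
  exact quadraticForm_inv_approx hpd h.posDef h0 h1 ((h.divergence_le hα hw).trans hg) (A i)

/-- Each fixed point minimizes the objective, so the gap between two of them is at most zero and `τ
= 0` is allowed in `rowForm_approx`. -/
theorem IsFixedPoint.unique {u v : Fin m → ℝ} (h : IsFixedPoint A α u) (h' : IsFixedPoint A α v)
    (hα : 0 < α) : u = v := by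
  have hle := h'.objective_le hα h.nonneg h.posDef
  funext i
  have h1 := h.rowForm_approx hα h'.nonneg h'.posDef le_rfl zero_le_one (by linarith) i
  have h2 : u i ^ α = v i ^ α := by
    rw [h'.eq]
    have := h1.1
    have := h1.2
    norm_num at *
    linarith
  exact (Real.rpow_left_inj (h.nonneg i) (h'.nonneg i) hα.ne').1 h2

/-! ### First order conditions -/

theorem objective_update_sub {u : Fin m → ℝ} (h : (gram A u).PosDef) (α : ℝ) (i : Fin m) {t : ℝ}
    (ht : 0 < 1 + t * rowForm A u i) :
    objective A α (Function.update u i (u i + t)) - objective A α u =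
      -Real.log (1 + t * rowForm A u i) +
        ((u i + t) ^ (1 + α) - u i ^ (1 + α)) / (1 + α) := by
  rw [objective_sub, det_gram_update h, Real.log_mul h.det_pos.ne' ht.ne']
  rw [Finset.sum_eq_single i (fun j _ hj => by rw [Function.update_of_ne hj]; simp)
    (fun hi => absurd (Finset.mem_univ i) hi), Function.update_self]
  ring

theorem eventually_one_add_mul_pos (r : ℝ) : ∀ᶠ t : ℝ in 𝓝 0, 0 < 1 + t * r := by
  have : Tendsto (fun t : ℝ => 1 + t * r) (𝓝 0) (𝓝 (1 + 0 * r)) :=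
    Continuous.tendsto (by fun_prop) 0
  rw [zero_mul, add_zero] at this
  exact this.eventually_const_lt one_pos

/-- The derivative of the objective in the `i`-th coordinate is `uᵢ ^ α - aᵢᵀ (Aᵀ U A)⁻¹ aᵢ`. The
minimality hypothesis only concerns this coordinate, so the lemma serves minimizers over the open
and over the closed orthant. -/
theorem rpow_eq_rowForm_of_min {u : Fin m → ℝ} (h : (gram A u).PosDef) (hα : 0 < α) {i : Fin m}
    (hi : 0 < u i)
    (hmin : ∀ t, 0 < u i + t → 0 < 1 + t * rowForm A u i →
      objective A α u ≤ objective A α (Function.update u i (u i + t))) :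
    u i ^ α = rowForm A u i := by
  set r := rowForm A u i
  let g : ℝ → ℝ := fun t => -Real.log (1 + t * r) + ((u i + t) ^ (1 + α) - u i ^ (1 + α)) / (1 + α)
  have hd : HasDerivAt g (-(r / (1 + 0 * r)) + (1 * (1 + α) * (u i + 0) ^ (1 + α - 1)) / (1 + α))
      0 := by
    have h1 : HasDerivAt (fun t : ℝ => 1 + t * r) r 0 := by
      simpa using ((hasDerivAt_id (0 : ℝ)).mul_const r).const_add 1
    have h2 : HasDerivAt (fun t : ℝ => u i + t) 1 0 := (hasDerivAt_id (0 : ℝ)).const_add _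
    exact ((h1.log (by norm_num)).neg).add
      (((h2.rpow_const (Or.inl (by rw [add_zero]; exact hi.ne'))).sub_const _).div_const _)
  have hlm : IsLocalMin g 0 := by
    have h1 := eventually_one_add_mul_pos r
    have h2 : ∀ᶠ t : ℝ in 𝓝 0, 0 < u i + t := by
      have : Tendsto (fun t : ℝ => u i + t) (𝓝 0) (𝓝 (u i + 0)) :=
        Continuous.tendsto (by fun_prop) 0
      rw [add_zero] at this
      exact this.eventually_const_lt hi
    filter_upwards [h1, h2] with t ht1 ht2
    have h3 := hmin t ht2 ht1
    have h4 := objective_update_sub h α i ht1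
    have h5 : g 0 = 0 := by simp [g]
    rw [h5]
    change 0 ≤ -Real.log (1 + t * r) + ((u i + t) ^ (1 + α) - u i ^ (1 + α)) / (1 + α)
    linarith
  have h0 := hlm.hasDerivAt_eq_zero hd
  rw [zero_mul, add_zero, div_one, add_zero, add_sub_cancel_left, one_mul,
    mul_div_cancel_left₀ _ (by linarith : (1 + α) ≠ 0)] at h0
  linarith

/-- On the boundary only `t > 0` can be tested. A log-det gain of order `t r` cannot be offset by `t
^ (1 + α)`: minimality gives `r ≤ t ^ α (1 + t r)`, which tends to zero. -/
theorem rowForm_eq_zero_of_min {u : Fin m → ℝ} (h : (gram A u).PosDef) (hα : 0 < α)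
    (hu : ∀ i, 0 ≤ u i) {i : Fin m} (hi : u i = 0)
    (hmin : ∀ t, 0 < t → objective A α u ≤ objective A α (Function.update u i (u i + t))) :
    rowForm A u i = 0 := by
  set r := rowForm A u i with hr
  have hr0 : 0 ≤ r := rowForm_nonneg A hu i
  refine le_antisymm ?_ hr0
  have hlim : Tendsto (fun t : ℝ => t ^ α * (1 + t * r)) (𝓝[>] 0) (𝓝 (0 ^ α * (1 + 0 * r))) :=
    ((Continuous.mul (Real.continuous_rpow_const hα.le)
      (by fun_prop)).tendsto 0).mono_left nhdsWithin_le_nhds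
  rw [Real.zero_rpow hα.ne', zero_mul] at hlim
  refine ge_of_tendsto hlim ?_
  filter_upwards [self_mem_nhdsWithin] with t ht
  have ht : 0 < t := ht
  have h1 : 0 < 1 + t * r := by positivity
  have h2 := objective_update_sub h α i h1
  rw [hi, zero_add, Real.zero_rpow (by linarith), sub_zero] at h2
  have h3 := hmin t ht
  rw [hi, zero_add] at h3
  have h4 := Real.one_sub_inv_le_log_of_pos h1
  have h5 : t ^ (1 + α) / (1 + α) ≤ t ^ (1 + α) :=
    div_le_self (Real.rpow_nonneg ht.le _) (by linarith)
  rw [rpow_one_add_eq hα ht.le] at h5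
  have h6 : t * r / (1 + t * r) ≤ t ^ α * t := by
    have : t * r / (1 + t * r) = 1 - (1 + t * r)⁻¹ := by field_simp; ring
    rw [this]
    rw [rpow_one_add_eq hα ht.le] at h2
    linarith
  rw [div_le_iff₀ h1] at h6
  refine le_of_mul_le_mul_left ?_ ht
  linarith

theorem gram_smul (A : Matrix (Fin m) (Fin n) ℝ) (w : Fin m → ℝ) (c : ℝ) :
    gram A (fun i => c * w i) = c • gram A w := by
  ext j k
  rw [Matrix.smul_apply, gram_apply, gram_apply, smul_eq_mul, Finset.mul_sum]
  exact Finset.sum_congr rfl fun i _ => by ring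

theorem uniform_sum_rpow_le (hn : 1 ≤ n) (hnm : n ≤ m) (hα : 0 < α) :
    ∑ _i : Fin m, ((n : ℝ) / m) ^ (1 + α) ≤ n := by
  have hm : (0 : ℝ) < m := by exact_mod_cast hn.trans hnm
  have h1 : ((n : ℝ) / m) ^ (1 + α) ≤ (n : ℝ) / m := by
    have : (n : ℝ) / m ≤ 1 := (div_le_one hm).2 (by exact_mod_cast hnm)
    calc ((n : ℝ) / m) ^ (1 + α) ≤ ((n : ℝ) / m) ^ (1 : ℝ) :=
          Real.rpow_le_rpow_of_exponent_ge (by positivity) this (by linarith)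
      _ = _ := Real.rpow_one _
  calc ∑ _i : Fin m, ((n : ℝ) / m) ^ (1 + α) ≤ ∑ _i : Fin m, (n : ℝ) / m :=
        Finset.sum_le_sum fun _ _ => h1
    _ = n := by simp; field_simp

theorem sum_rpow_pos (hn : 1 ≤ n) (h : (gram A w).PosDef) (hw : ∀ i, 0 ≤ w i) (a : ℝ) :
    0 < ∑ i, w i ^ a := by
  have h1 := sum_mul_rowForm h
  have hn' : (0 : ℝ) < n := by exact_mod_cast hn
  obtain ⟨i, -, hi⟩ : ∃ i ∈ Finset.univ, w i * rowForm A w i ≠ 0 :=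
    Finset.exists_ne_zero_of_sum_ne_zero (by rw [h1]; exact hn'.ne')
  exact Finset.sum_pos' (fun i _ => Real.rpow_nonneg (hw i) a) ⟨i, Finset.mem_univ i,
    Real.rpow_pos_of_pos ((hw i).lt_of_ne (left_ne_zero_of_mul hi).symm) a⟩

/-- The objective attains its minimum over the nonnegative vectors with invertible Gram matrix: a
maximizer of the determinant over `{w ≥ 0 | ∑ wᵢ ^ (1 + α) ≤ n}` is a minimizer. -/
theorem exists_min_objective (hn : 1 ≤ n) (hnm : n ≤ m) (hA : A.rank = n) (hα : 0 < α) :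
    ∃ u : Fin m → ℝ, (∀ i, 0 ≤ u i) ∧ (gram A u).PosDef ∧ ∀ w : Fin m → ℝ, (∀ i, 0 ≤ w i) →
      (gram A w).PosDef → objective A α u ≤ objective A α w := by
  have hn' : (0 : ℝ) < n := by exact_mod_cast hn
  have hm : (0 : ℝ) < m := by exact_mod_cast hn.trans hnm
  let K : Set (Fin m → ℝ) := {w | 0 ≤ w} ∩ {w | ∑ i, w i ^ (1 + α) ≤ n}
  have hKc : IsClosed K := by
    refine (isClosed_le continuous_const continuous_id).inter (isClosed_le ?_ continuous_const)
    exact continuous_finsetSum _ fun i _ =>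
      (continuous_apply i).rpow_const fun _ => Or.inr (by linarith)
  -- A coordinate exceeding `n ≥ 1` would have `wᵢ ^ (1 + α) ≥ wᵢ > n`.
  have hKb : K ⊆ Set.Icc 0 (fun _ => (n : ℝ)) := by
    rintro w ⟨hw0, hw⟩
    refine ⟨hw0, fun i => ?_⟩
    by_contra! hlt
    have h1 : (1 : ℝ) ≤ w i := (by exact_mod_cast hn : (1 : ℝ) ≤ n).trans hlt.le
    have h2 := Real.self_le_rpow_of_one_le h1 (by linarith : 1 ≤ 1 + α)
    have h3 : w i ^ (1 + α) ≤ ∑ i, w i ^ (1 + α) :=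
      Finset.single_le_sum (f := fun i => w i ^ (1 + α))
        (fun j _ => Real.rpow_nonneg (hw0 j) _) (Finset.mem_univ i)
    have h4 : ∑ i, w i ^ (1 + α) ≤ n := hw
    linarith
  have hK : IsCompact K := isCompact_Icc.of_isClosed_subset hKc hKb
  have hw0 : (fun _ => (n : ℝ) / m) ∈ K :=
    ⟨fun i => by positivity, uniform_sum_rpow_le hn hnm hα⟩
  have hcont : Continuous fun w : Fin m → ℝ => (gram A w).det := by
    unfold gram
    fun_prop
  obtain ⟨u, huK, hu⟩ := hK.exists_isMaxOn ⟨_, hw0⟩ hcont.continuousOn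
  have hupos : 0 < (gram A u).det :=
    (gram_posDef hA fun _ => by positivity).det_pos.trans_le (hu hw0)
  have hupd : (gram A u).PosDef := gram_posDef_of_isUnit huK.1
    ((isUnit_iff_isUnit_det _).2 hupos.ne'.isUnit)
  refine ⟨u, huK.1, hupd, fun w hw hpd => ?_⟩
  set s := ∑ i, w i ^ (1 + α) with hs
  have hspos : 0 < s := sum_rpow_pos hn hpd hw _
  -- The scaling that brings `w` to the boundary of `K`, where the power sum equals `n`.
  set c := ((n : ℝ) / s) ^ (1 / (1 + α)) with hc
  have hns : 0 < (n : ℝ) / s := by positivity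
  have hcpos : 0 < c := Real.rpow_pos_of_pos hns _
  have hα1 : 0 < 1 + α := by linarith
  have hcw : (fun i => c * w i) ∈ K := by
    refine ⟨fun i => mul_nonneg hcpos.le (hw i), ?_⟩
    change ∑ i, (c * w i) ^ (1 + α) ≤ n
    have h1 : ∀ i, (c * w i) ^ (1 + α) = n / s * w i ^ (1 + α) := by
      intro i
      rw [Real.mul_rpow hcpos.le (hw i), hc, ← Real.rpow_mul hns.le,
        one_div_mul_cancel hα1.ne', Real.rpow_one]
    rw [Finset.sum_congr rfl fun i _ => h1 i, ← Finset.mul_sum, ← hs, div_mul_cancel₀ _ hspos.ne']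
  have hdet := hu hcw
  simp only [Set.mem_ofPred_eq] at hdet
  rw [gram_smul, det_smul, Fintype.card_fin] at hdet
  have hlog := Real.log_le_log (mul_pos (pow_pos hcpos n) hpd.det_pos) hdet
  rw [Real.log_mul (pow_pos hcpos n).ne' hpd.det_pos.ne', Real.log_pow, hc,
    Real.log_rpow hns, Real.log_div hn'.ne' hspos.ne'] at hlog
  -- The rescaling changes log det by `n log c`; this inequality shows that the change of the power
  -- sum pays for it.
  have h5 : Real.log s - Real.log n ≤ s / n - 1 := by
    rw [← Real.log_div hspos.ne' hn'.ne']
    exact Real.log_le_sub_one_of_pos (by positivity)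
  have h6 : (n : ℝ) * (1 / (1 + α) * (Real.log s - Real.log n)) ≤ 1 / (1 + α) * (s - n) := by
    calc (n : ℝ) * (1 / (1 + α) * (Real.log s - Real.log n))
        ≤ (n : ℝ) * (1 / (1 + α) * (s / n - 1)) := by gcongr
      _ = _ := by field_simp
  have h7 : 1 / (1 + α) * ∑ i, u i ^ (1 + α) ≤ 1 / (1 + α) * n :=
    mul_le_mul_of_nonneg_left huK.2 (by positivity)
  rw [objective_eq, objective_eq, ← hs]
  linarith

/-- At a minimizer over the closed orthant, positive coordinates satisfy the derivative condition,
and vanishing ones have vanishing quadratic form, so that both sides of the equation are zero. The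
rank-one determinant formula keeps the variations in the domain. -/
theorem exists_isFixedPoint (hn : 1 ≤ n) (hnm : n ≤ m) (hA : A.rank = n) (hα : 0 < α) :
    ∃ u, IsFixedPoint A α u := by
  obtain ⟨u, hu, hpd, hmin⟩ := exists_min_objective hn hnm hA hα
  have hm : ∀ i t, 0 ≤ u i + t → 0 < 1 + t * rowForm A u i →
      objective A α u ≤ objective A α (Function.update u i (u i + t)) := by
    intro i t h0 h1
    have h2 : ∀ j, 0 ≤ Function.update u i (u i + t) j := by
      intro j
      rcases eq_or_ne j i with rfl | hj
      · rwa [Function.update_self]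
      · rw [Function.update_of_ne hj]; exact hu j
    refine hmin _ h2 (gram_posDef_of_isUnit h2 ((isUnit_iff_isUnit_det _).2 ?_))
    rw [det_gram_update hpd]
    exact (mul_pos hpd.det_pos h1).ne'.isUnit
  refine ⟨u, hu, hpd, fun i => ?_⟩
  rcases (hu i).lt_or_eq with hi | hi
  · exact rpow_eq_rowForm_of_min hpd hα hi fun t h0 h1 => hm i t h0.le h1
  · rw [rowForm_eq_zero_of_min hpd hα hu hi.symm fun t ht => hm i t (by linarith)
      (by have := rowForm_nonneg A hu i; positivity), ← hi, Real.zero_rpow hα.ne']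

theorem IsOptimal.isFixedPoint {u : Fin m → ℝ} (hA : A.rank = n) (hα : 0 < α)
    (h : IsOptimal A α u) : IsFixedPoint A α u := by
  have hpd := gram_posDef hA h.1
  refine ⟨fun i => (h.1 i).le, hpd, fun i => rpow_eq_rowForm_of_min hpd hα (h.1 i) ?_⟩
  intro t h0 _
  refine h.2 _ fun j => ?_
  rcases eq_or_ne j i with rfl | hj
  · rwa [Function.update_self]
  · rw [Function.update_of_ne hj]; exact h.1 j

/-- A nonzero row has a positive quadratic form, hence `uᵢ > 0`. -/
theorem IsFixedPoint.isOptimal {u : Fin m → ℝ} (hA : A.rank = n) (hα : 0 < α)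
    (h : IsFixedPoint A α u) (h0 : ∀ i, A i ≠ 0) : IsOptimal A α u := by
  refine ⟨fun i => ?_, fun w hw => h.objective_le hα (fun i => (hw i).le) (gram_posDef hA hw)⟩
  refine (h.nonneg i).lt_of_ne fun hi => ?_
  have h1 := h.eq i
  rw [← hi, Real.zero_rpow hα.ne'] at h1
  exact (rowForm_pos h.posDef (h0 i)).ne h1

theorem existsUnique_isOptimal (hn : 1 ≤ n) (hnm : n ≤ m) (hA : A.rank = n) (hα : 0 < α)
    (h0 : ∀ i, A i ≠ 0) : ∃! u : Fin m → ℝ, IsOptimal A α u := by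
  obtain ⟨u, hu⟩ := exists_isFixedPoint hn hnm hA hα
  exact ⟨u, hu.isOptimal hA hα h0, fun v hv => (hv.isFixedPoint hA hα).unique hu hα⟩

/-! ### Lewis weights and fixed points -/

theorem alpha_pos {p : ℝ} (hp : 4 ≤ p) : 0 < alpha p := div_pos two_pos (by linarith)

theorem alpha_le_one {p : ℝ} (hp : 4 ≤ p) : alpha p ≤ 1 := by
  rw [alpha, div_le_one (by linarith)]
  linarith

theorem one_add_alpha {p : ℝ} (hp : 4 ≤ p) : 1 + alpha p = p / (p - 2) := by
  have : p - 2 ≠ 0 := by linarith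
  rw [alpha]
  field_simp
  ring

theorem one_sub_two_div_mul {p : ℝ} (hp : 4 ≤ p) : (1 - 2 / p) * (1 + alpha p) = 1 := by
  have : p - 2 ≠ 0 := by linarith
  have : p ≠ 0 := by linarith
  rw [one_add_alpha hp]
  field_simp

theorem one_sub_two_div_mul_alpha {p : ℝ} (hp : 4 ≤ p) : (1 - 2 / p) * alpha p = 2 / p := by
  have := one_sub_two_div_mul hp
  linarith

theorem IsLewisWeights.isFixedPoint {p : ℝ} (hp : 4 ≤ p) {v : Fin m → ℝ}
    (h : IsLewisWeights A p v) : IsFixedPoint A (alpha p) fun i => v i ^ (1 - 2 / p) where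
  nonneg i := Real.rpow_nonneg (h.nonneg i) _
  posDef := gram_posDef_of_isUnit (fun i => Real.rpow_nonneg (h.nonneg i) _) h.isUnit
  eq i := by
    rw [← Real.rpow_mul (h.nonneg i), one_sub_two_div_mul_alpha hp]
    exact h.eq i

theorem IsFixedPoint.isLewisWeights {p : ℝ} (hp : 4 ≤ p) {u : Fin m → ℝ}
    (h : IsFixedPoint A (alpha p) u) : IsLewisWeights A p fun i => u i ^ (1 + alpha p) := by
  have h1 : (fun j => (u j ^ (1 + alpha p)) ^ (1 - 2 / p)) = u := by
    funext j
    rw [← Real.rpow_mul (h.nonneg j), mul_comm, one_sub_two_div_mul hp, Real.rpow_one]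
  refine ⟨fun i => Real.rpow_nonneg (h.nonneg i) _, ?_, fun i => ?_⟩
  · rw [h1]; exact h.posDef.isUnit
  · have h2 : (1 + alpha p) * (2 / p) = alpha p := by
      rw [← one_sub_two_div_mul_alpha hp]
      linear_combination (alpha p) * one_sub_two_div_mul hp
    rw [h1, ← Real.rpow_mul (h.nonneg i), h2]
    exact h.eq i

theorem existsUnique_isLewisWeights {p : ℝ} (hn : 1 ≤ n) (hnm : n ≤ m) (hA : A.rank = n)
    (hp : 4 ≤ p) : ∃! v : Fin m → ℝ, IsLewisWeights A p v := by
  obtain ⟨u, hu⟩ := exists_isFixedPoint hn hnm hA (alpha_pos hp)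
  refine ⟨_, hu.isLewisWeights hp, fun v hv => ?_⟩
  have h := (hv.isFixedPoint hp).unique hu (alpha_pos hp)
  funext i
  rw [← h]
  change v i = (v i ^ (1 - 2 / p)) ^ (1 + alpha p)
  rw [← Real.rpow_mul (hv.nonneg i), one_sub_two_div_mul hp, Real.rpow_one]

end

/-! ### Convergence: progress of descent steps, termination of rounding, and the main loop. -/

section

variable {m n : ℕ} {A : Matrix (Fin m) (Fin n) ℝ} {w : Fin m → ℝ} {α : ℝ}

/-! ### The ratios `ρᵢ` -/

theorem rho_mul_rpow (hw : ∀ i, 0 < w i) (i : Fin m) :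
    rho A α w i * w i ^ (1 + α) = w i * rowForm A w i := by
  rw [rho, div_mul_cancel₀ _ (Real.rpow_pos_of_pos (hw i) _).ne',
    sigma_eq A w (fun i => (hw i).le)]

theorem rho_eq_div (hα : 0 < α) (hw : ∀ i, 0 < w i) (i : Fin m) :
    rho A α w i = rowForm A w i / w i ^ α := by
  have h1 := (hw i).ne'
  rw [rho, sigma_eq A w (fun i => (hw i).le), rpow_one_add_eq hα (hw i).le, mul_comm,
    mul_div_mul_right _ _ h1]

theorem rho_nonneg (hw : ∀ i, 0 < w i) (i : Fin m) : 0 ≤ rho A α w i := by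
  rw [rho, sigma_eq A w (fun i => (hw i).le)]
  exact div_nonneg (mul_nonneg (hw i).le (rowForm_nonneg A (fun i => (hw i).le) i))
    (Real.rpow_nonneg (hw i).le _)

theorem stepSize_eq (hα : α ≤ 1) (i : Fin m) : stepSize m α i = 1 / 3 := by
  rw [stepSize, max_eq_right hα, mul_one]

open Classical in
/-- The factor by which a descent step multiplies the `i`-th coordinate. -/
def descentFactor (A : Matrix (Fin m) (Fin n) ℝ) (α : ℝ) (w : Fin m → ℝ) (C : Set (Fin m))
    (i : Fin m) : ℝ :=
  if i ∈ C then 1 + 1 / 3 * ((rho A α w i - 1) / (rho A α w i + 1)) else 1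

theorem descent_eq (hα : α ≤ 1) (C : Set (Fin m)) :
    descent A α w C (stepSize m α) = fun i => descentFactor A α w C i * w i := by
  funext i
  simp only [descent, descentFactor, stepSize_eq hα]
  split_ifs <;> ring

theorem abs_sub_one_div_add_one_le {ρ : ℝ} (h : 0 ≤ ρ) : |(ρ - 1) / (ρ + 1)| ≤ 1 := by
  rw [abs_div, abs_of_pos (by linarith : 0 < ρ + 1), div_le_one (by linarith), abs_le]
  constructor <;> linarith

theorem descentFactor_mem (hw : ∀ i, 0 < w i) (C : Set (Fin m)) (i : Fin m) :
    2 / 3 ≤ descentFactor A α w C i ∧ descentFactor A α w C i ≤ 4 / 3 := by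
  have h := abs_le.1 (abs_sub_one_div_add_one_le (rho_nonneg (A := A) (α := α) hw i))
  rw [descentFactor]
  split_ifs
  · constructor <;> linarith [h.1, h.2]
  · norm_num

theorem descentFactor_pos (hw : ∀ i, 0 < w i) (C : Set (Fin m)) (i : Fin m) :
    0 < descentFactor A α w C i := by linarith [(descentFactor_mem (A := A) (α := α) hw C i).1]

theorem descent_pos (hα : α ≤ 1) (hw : ∀ i, 0 < w i) (C : Set (Fin m)) (i : Fin m) :
    0 < descent A α w C (stepSize m α) i := by
  rw [descent_eq hα]
  exact mul_pos (descentFactor_pos hw C i) (hw i)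

/-! ### Progress of a descent step -/

/-- The potential `wᵢ ^ (1 + α) (ρᵢ - 1)² / (ρᵢ + 1)`. -/
def residual (A : Matrix (Fin m) (Fin n) ℝ) (α : ℝ) (w : Fin m → ℝ) (i : Fin m) : ℝ :=
  w i ^ (1 + α) * ((rho A α w i - 1) ^ 2 / (rho A α w i + 1))

theorem residual_nonneg (hw : ∀ i, 0 < w i) (i : Fin m) : 0 ≤ residual A α w i := by
  have := rho_nonneg (A := A) (α := α) hw i
  exact mul_nonneg (Real.rpow_nonneg (hw i).le _) (div_nonneg (sq_nonneg _) (by linarith))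

/-- The change of the objective caused by one coordinate, divided by `wᵢ ^ (1 + α)`: the first term
comes from the decoupled log-determinant, the second from the power. Both are expanded to second
order in `t = d - 1`. -/
theorem descent_scalar_bound (h0 : 0 < α) (h1 : α ≤ 1) {ρ : ℝ} (hρ : 0 ≤ ρ) {d : ℝ}
    (hd : d = 1 + 1 / 3 * ((ρ - 1) / (ρ + 1))) :
    ρ * (d⁻¹ - 1) + (d ^ (1 + α) - 1) / (1 + α) ≤ -(1 / 6 * ((ρ - 1) ^ 2 / (ρ + 1))) := by
  set x := (ρ - 1) / (ρ + 1) with hx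
  have hρ1 : 0 < ρ + 1 := by linarith
  have hxb := abs_le.1 (abs_sub_one_div_add_one_le hρ)
  set t := 1 / 3 * x with ht
  have htb : -(1 / 3) ≤ t ∧ t ≤ 1 / 3 := by constructor <;> linarith [hxb.1, hxb.2]
  have hdpos : 0 < d := by linarith [htb.1]
  have hxe : ρ - 1 = x * (ρ + 1) := by rw [hx, div_mul_cancel₀ _ hρ1.ne']
  have hsq : (ρ - 1) ^ 2 / (ρ + 1) = x ^ 2 * (ρ + 1) := by
    rw [hxe]; field_simp
  -- `(1 - t + 3/2 t²)(1 + t) = 1 + 3/2 t² (1/3 + t)`, which is at least `1` because the step size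
  -- keeps `t ≥ -1/3`.
  have hinv : d⁻¹ - 1 ≤ -t + 3 / 2 * t ^ 2 := by
    have h2 : d⁻¹ ≤ 1 - t + 3 / 2 * t ^ 2 := by
      rw [inv_le_iff_one_le_mul₀ hdpos, hd]
      nlinarith [mul_nonneg (sq_nonneg t) (by linarith [htb.1] : 0 ≤ 1 / 3 + t)]
    linarith
  have hpow : (d ^ (1 + α) - 1) / (1 + α) ≤ t + 1 / 2 * t ^ 2 := by
    have h2 : d ^ α ≤ 1 + α * t := by
      rw [hd]
      exact rpow_one_add_le_one_add_mul_self (by linarith [htb.1]) h0.le h1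
    rw [rpow_one_add_eq h0 hdpos.le, div_le_iff₀ (by linarith)]
    have h3 : d ^ α * d ≤ (1 + α * t) * d := mul_le_mul_of_nonneg_right h2 hdpos.le
    rw [hd] at h3 ⊢
    nlinarith [sq_nonneg t]
  have h4 : ρ * (d⁻¹ - 1) ≤ ρ * (-t + 3 / 2 * t ^ 2) := mul_le_mul_of_nonneg_left hinv hρ
  rw [hsq]
  have h5 : ρ * (-t + 3 / 2 * t ^ 2) + (t + 1 / 2 * t ^ 2) ≤
      -(t * (ρ - 1)) + 3 / 2 * t ^ 2 * (ρ + 1) := by nlinarith [sq_nonneg t]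
  -- With `t = x/3` the first-order gain is `x² (ρ + 1) / 3`, and the second-order loss is half of
  -- it.
  have h6 : -(t * (ρ - 1)) + 3 / 2 * t ^ 2 * (ρ + 1) = -(1 / 6 * (x ^ 2 * (ρ + 1))) := by
    rw [hxe, ht]; ring
  linarith

open Classical in
theorem objective_descent_le (hA : A.rank = n) (h0 : 0 < α) (h1 : α ≤ 1) (hw : ∀ i, 0 < w i)
    (C : Set (Fin m)) :
    objective A α (descent A α w C (stepSize m α)) ≤
      objective A α w - 1 / 6 * ∑ i, if i ∈ C then residual A α w i else 0 := by
  rw [descent_eq h1]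
  set d := descentFactor A α w C with hd
  have hdp : ∀ i, 0 < d i := descentFactor_pos hw C
  have hpd := gram_posDef hA hw
  have hpd' : (gram A fun i => d i * w i).PosDef := gram_posDef hA fun i => mul_pos (hdp i) (hw i)
  have h2 := log_det_sub_le hpd hpd'
  rw [trace_inv_mul_gram] at h2
  have h3 := sum_mul_rowForm_le hpd (fun i => (hw i).le) hdp hpd'
  have h4 := sum_mul_rowForm hpd
  have h5 := objective_sub A α (fun i => d i * w i) w
  have h6 : ∑ i, (w i * rowForm A w i / d i - w i * rowForm A w i +
      ((d i * w i) ^ (1 + α) - w i ^ (1 + α)) / (1 + α)) ≤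
      ∑ i, -(1 / 6 * if i ∈ C then residual A α w i else 0) := by
    refine Finset.sum_le_sum fun i _ => ?_
    rw [Real.mul_rpow (hdp i).le (hw i).le, ← rho_mul_rpow hw i]
    have hwp := Real.rpow_pos_of_pos (hw i) (1 + α)
    by_cases hi : i ∈ C
    · rw [if_pos hi, residual]
      have h7 := descent_scalar_bound h0 h1 (rho_nonneg (A := A) (α := α) hw i) (d := d i)
        (by rw [hd, descentFactor, if_pos hi])
      have h8 := mul_le_mul_of_nonneg_left h7 hwp.le
      refine le_trans (le_of_eq ?_) (h8.trans (le_of_eq ?_)) <;> ring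
    · rw [if_neg hi, hd, descentFactor, if_neg hi]
      simp
  rw [Finset.sum_add_distrib, Finset.sum_sub_distrib, Finset.sum_neg_distrib, ← Finset.mul_sum]
    at h6
  linarith

theorem objective_descent_le_self (hA : A.rank = n) (h0 : 0 < α) (h1 : α ≤ 1)
    (hw : ∀ i, 0 < w i) (C : Set (Fin m)) :
    objective A α (descent A α w C (stepSize m α)) ≤ objective A α w := by
  classical
  have h := objective_descent_le hA h0 h1 hw C
  have h2 : 0 ≤ ∑ i, if i ∈ C then residual A α w i else 0 :=
    Finset.sum_nonneg fun i _ => by split_ifs <;> simp [residual_nonneg hw]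
  linarith

/-- Young's inequality removes `x`, leaving `ρ ^ ((1 + α) / α)`. Writing `ρ = 1 + αs`, rounding
means `s ≤ 1`, so `ρ ^ (1/α) ≤ exp s ≤ 1 + s + s²`. Without rounding this power would grow too fast
to be bounded by the residual. -/
theorem rounded_scalar_bound (h0 : 0 < α) (h1 : α ≤ 1) {ρ x : ℝ} (hρ : 0 ≤ ρ) (hρ1 : ρ ≤ 1 + α)
    (hx : 0 ≤ x) :
    ρ * (x - 1) + (1 - x ^ (1 + α)) / (1 + α) ≤ 9 / (2 * α) * ((ρ - 1) ^ 2 / (ρ + 1)) := by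
  have hY := mul_le_rpow_one_add h0 hρ hx
  set s := (ρ - 1) / α with hs
  have hρs : ρ = 1 + α * s := by rw [hs]; field_simp; ring
  have hs1 : s ≤ 1 := by rw [hs, div_le_one h0]; linarith
  have hpow : ρ ^ ((1 + α) / α) ≤ ρ * (1 + s + s ^ 2) := by
    rcases hρ.eq_or_lt with h | h
    · rw [← h, Real.zero_rpow (by positivity), zero_mul]
    · have he : (1 + α) / α = 1 + 1 / α := by field_simp; ring
      rw [he, Real.rpow_add h, Real.rpow_one]
      refine mul_le_mul_of_nonneg_left ?_ hρ
      calc ρ ^ (1 / α) = Real.exp (Real.log ρ * (1 / α)) := Real.rpow_def_of_pos h _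
        _ ≤ Real.exp s := by
            refine Real.exp_le_exp.2 ?_
            rw [mul_one_div, hs]
            exact div_le_div_of_nonneg_right (Real.log_le_sub_one_of_pos h) h0.le
        _ ≤ 1 + s + s ^ 2 := by
            rcases le_or_gt (-1) s with h2 | h2
            · have := (abs_le.1 (Real.abs_exp_sub_one_sub_id_le (abs_le.2 ⟨h2, hs1⟩))).2
              linarith
            · have : Real.exp s ≤ 1 := Real.exp_le_one_iff.2 (by linarith)
              nlinarith
  have hα1 : 0 < 1 + α := by linarith
  have h3 : α / (1 + α) * ρ ^ ((1 + α) / α) ≤ α / (1 + α) * (ρ * (1 + s + s ^ 2)) :=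
    mul_le_mul_of_nonneg_left hpow (by positivity)
  have h4 : α / (1 + α) * (ρ * (1 + s + s ^ 2)) + 1 / (1 + α) - ρ ≤ 3 / 2 * α * s ^ 2 := by
    have : α / (1 + α) * (ρ * (1 + s + s ^ 2)) + 1 / (1 + α) - ρ =
        α * s ^ 2 * ((1 + α + α * s) / (1 + α)) := by
      rw [hρs]; field_simp; ring
    rw [this]
    have h5 : (1 + α + α * s) / (1 + α) ≤ 3 / 2 := by
      rw [div_le_iff₀ hα1]; nlinarith
    nlinarith [mul_le_mul_of_nonneg_left h5 (by positivity : 0 ≤ α * s ^ 2)]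
  -- Here `ρ + 1 ≤ 3`.
  have h6 : 3 / 2 * α * s ^ 2 ≤ 9 / (2 * α) * ((ρ - 1) ^ 2 / (ρ + 1)) := by
    have h7 : 3 / 2 * α * s ^ 2 = 9 / (2 * α) * ((ρ - 1) ^ 2 / 3) := by
      rw [hs]; field_simp; ring
    rw [h7]
    gcongr
    linarith
  rw [sub_div]
  linarith

/-- Concavity of log det at `w` bounds the gap by a sum over coordinates; divided by `wᵢ ^ (1 + α)`,
each term is the left side of `rounded_scalar_bound` at `x = uᵢ / wᵢ`. -/
theorem IsFixedPoint.gap_le {u : Fin m → ℝ} (hu : IsFixedPoint A α u) (hA : A.rank = n)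
    (h0 : 0 < α) (h1 : α ≤ 1) (hw : ∀ i, 0 < w i) (hρ : ∀ i, rho A α w i ≤ 1 + α) :
    objective A α w - objective A α u ≤ 9 / (2 * α) * ∑ i, residual A α w i := by
  have hpd := gram_posDef hA hw
  have h2 := log_det_sub_le hu.posDef hpd
  rw [trace_inv_mul_gram, ← sum_mul_rowForm hpd] at h2
  have h3 : ∑ i, (u i * rowForm A w i - w i * rowForm A w i +
      (w i ^ (1 + α) - u i ^ (1 + α)) / (1 + α)) ≤
      ∑ i, 9 / (2 * α) * residual A α w i := by
    refine Finset.sum_le_sum fun i _ => ?_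
    have hwi := hw i
    have h4 := rounded_scalar_bound h0 h1 (rho_nonneg (A := A) (α := α) hw i) (hρ i)
      (div_nonneg (hu.nonneg i) hwi.le)
    have hwp := Real.rpow_pos_of_pos hwi (1 + α)
    have h5 := mul_le_mul_of_nonneg_left h4 hwp.le
    rw [Real.div_rpow (hu.nonneg i) hwi.le] at h5
    have h6 := rho_mul_rpow (A := A) (α := α) hw i
    rw [residual]
    refine le_trans (le_of_eq ?_) (h5.trans (le_of_eq ?_))
    · have h7 : u i * rowForm A w i = u i / w i * (w i * rowForm A w i) := by field_simp
      rw [h7, ← h6]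
      field_simp
    · ring
  rw [Finset.sum_add_distrib, Finset.sum_sub_distrib, ← Finset.mul_sum] at h3
  rw [objective_sub]
  linarith

/-- A full descent step from a rounded point contracts the gap. -/
theorem IsFixedPoint.gap_descent_le {u : Fin m → ℝ} (hu : IsFixedPoint A α u) (hA : A.rank = n)
    (h0 : 0 < α) (h1 : α ≤ 1) (hw : ∀ i, 0 < w i) (hρ : ∀ i, rho A α w i ≤ 1 + α) :
    objective A α (descent A α w Set.univ (stepSize m α)) - objective A α u ≤
      (1 - α / 27) * (objective A α w - objective A α u) := by
  classical
  have h2 := objective_descent_le hA h0 h1 hw Set.univ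
  simp only [Set.mem_univ, if_true] at h2
  have h3 := hu.gap_le hA h0 h1 hw hρ
  have h4 : α / 27 * (objective A α w - objective A α u) ≤ 1 / 6 * ∑ i, residual A α w i := by
    calc α / 27 * (objective A α w - objective A α u)
        ≤ α / 27 * (9 / (2 * α) * ∑ i, residual A α w i) := by gcongr
      _ = _ := by field_simp; ring
  linarith

/-- Leverage scores are at most one, so `uᵢ ≤ 1`. At the uniform weights the quadratic forms sum to
`m`, hence log det contributes at most `m - n`, and the powers at most `n`. -/
theorem IsFixedPoint.initial_gap_le {u : Fin m → ℝ} (hu : IsFixedPoint A α u) (hA : A.rank = n)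
    (hn : 1 ≤ n) (hnm : n ≤ m) (h0 : 0 < α) :
    objective A α (fun _ => (n : ℝ) / m) - objective A α u ≤ m := by
  have hn' : (0 : ℝ) < n := by exact_mod_cast hn
  have hm : (0 : ℝ) < m := by exact_mod_cast hn.trans hnm
  have hw : ∀ _i : Fin m, 0 < (n : ℝ) / m := fun _ => by positivity
  have hpd := gram_posDef hA hw
  have h2 := log_det_sub_le hu.posDef hpd
  rw [trace_inv_mul_gram] at h2
  have h3 : ∑ i, u i * rowForm A (fun _ => (n : ℝ) / m) i ≤
      ∑ i, rowForm A (fun _ => (n : ℝ) / m) i := by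
    refine Finset.sum_le_sum fun i _ =>
      mul_le_of_le_one_left (rowForm_nonneg A (fun i => (hw i).le) i) ?_
    by_contra! hc
    have h4 := mul_rowForm_le_one hu.posDef hu.nonneg i
    rw [← hu.eq, mul_comm, ← rpow_one_add_eq h0 (hu.nonneg i)] at h4
    exact absurd h4 (not_le.2 (Real.one_lt_rpow hc (by linarith)))
  have h5 := sum_mul_rowForm hpd
  rw [← Finset.mul_sum] at h5
  have h6 : ∑ i, rowForm A (fun _ => (n : ℝ) / m) i = m := by
    rw [div_mul_eq_mul_div, div_eq_iff hm.ne'] at h5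
    exact mul_left_cancel₀ hn'.ne' h5
  have h7 : ∑ i, (((n : ℝ) / m) ^ (1 + α) - u i ^ (1 + α)) / (1 + α) ≤ n := by
    refine le_trans (Finset.sum_le_sum fun i _ => ?_) (uniform_sum_rpow_le (α := α) hn hnm h0)
    have h8 := Real.rpow_nonneg (hu.nonneg i) (1 + α)
    have h9 := Real.rpow_nonneg (hw i).le (1 + α)
    rw [div_le_iff₀ (by linarith)]
    nlinarith
  rw [objective_sub]
  linarith

/-! ### Rounding -/

/-- The bound `c` on all coordinates controls the quadratic form in the numerator of `ρᵢ`, the bound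
`b` on the `i`-th one controls the denominator. -/
theorem rho_le_of_scale (hA : A.rank = n) (hα : 0 < α) (hw : ∀ i, 0 < w i) {w' : Fin m → ℝ}
    {c b : ℝ} (hc : 0 < c) (hb : 0 < b) (hle : ∀ i, c * w i ≤ w' i) (i : Fin m)
    (hi : b * w i ≤ w' i) : rho A α w' i ≤ c⁻¹ * (b ^ α)⁻¹ * rho A α w i := by
  have hw' : ∀ i, 0 < w' i := fun i => (mul_pos hc (hw i)).trans_le (hle i)
  rw [rho_eq_div hα hw, rho_eq_div hα hw']
  have h1 := rowForm_le_of_le hA hw hc hle i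
  have h2 : b ^ α * w i ^ α ≤ w' i ^ α := by
    rw [← Real.mul_rpow hb.le (hw i).le]
    exact Real.rpow_le_rpow (mul_pos hb (hw i)).le hi hα.le
  have hwp := Real.rpow_pos_of_pos (hw i) α
  have hbp := Real.rpow_pos_of_pos hb α
  have hr := rowForm_nonneg A (fun i => (hw i).le) i
  calc rowForm A w' i / w' i ^ α ≤ (c⁻¹ * rowForm A w i) / (b ^ α * w i ^ α) := by
        gcongr
    _ = _ := by field_simp

theorem rho_descent_univ_le (hA : A.rank = n) (h0 : 0 < α) (h1 : α ≤ 1) (hw : ∀ i, 0 < w i)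
    (hρ : ∀ i, rho A α w i ≤ 1 + α) (i : Fin m) :
    rho A α (descent A α w Set.univ (stepSize m α)) i ≤ 5 := by
  have hle : ∀ i, 2 / 3 * w i ≤ descent A α w Set.univ (stepSize m α) i := fun i => by
    rw [descent_eq h1]
    exact mul_le_mul_of_nonneg_right (descentFactor_mem hw _ i).1 (hw i).le
  have h2 := rho_le_of_scale hA h0 hw (by norm_num) (by norm_num) hle i (hle i)
  have h3 : ((2 / 3 : ℝ) ^ α)⁻¹ ≤ 3 / 2 := by
    have : (2 / 3 : ℝ) ^ (1 : ℝ) ≤ (2 / 3 : ℝ) ^ α :=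
      Real.rpow_le_rpow_of_exponent_ge (by norm_num) (by norm_num) h1
    rw [Real.rpow_one] at this
    rw [inv_le_comm₀ (by linarith) (by norm_num)]
    linarith
  have h4 := hρ i
  have h5 := rho_nonneg (A := A) (α := α) hw i
  have h6 : 0 ≤ ((2 / 3 : ℝ) ^ α)⁻¹ := by positivity
  calc _ ≤ (2 / 3 : ℝ)⁻¹ * ((2 / 3 : ℝ) ^ α)⁻¹ * rho A α w i := h2
    -- A full step shrinks no weight by more than `2/3`, and `ρ ≤ 1 + α ≤ 2` before it.
    _ ≤ (2 / 3 : ℝ)⁻¹ * (3 / 2) * 2 := by gcongr; linarith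
    _ ≤ 5 := by norm_num

theorem rho_uniform_le (hA : A.rank = n) (hn : 1 ≤ n) (hnm : n ≤ m) (h0 : 0 < α) (h1 : α ≤ 1)
    (i : Fin m) : rho A α (fun _ => (n : ℝ) / m) i ≤ (m : ℝ) ^ 2 := by
  have hn' : (1 : ℝ) ≤ n := by exact_mod_cast hn
  have hm : (1 : ℝ) ≤ m := by exact_mod_cast hn.trans hnm
  have hw : ∀ _i : Fin m, 0 < (n : ℝ) / m := fun _ => by positivity
  have h2 := mul_rowForm_le_one (gram_posDef hA hw) (fun i => (hw i).le) i
  rw [rho, sigma_eq A _ (fun i => (hw i).le)]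
  have h3 : ((m : ℝ) ^ 2)⁻¹ ≤ ((n : ℝ) / m) ^ (1 + α) := by
    calc ((m : ℝ) ^ 2)⁻¹ = (1 / (m : ℝ)) ^ (2 : ℝ) := by
          rw [Real.rpow_two, one_div, inv_pow]
      _ ≤ (1 / (m : ℝ)) ^ (1 + α) := Real.rpow_le_rpow_of_exponent_ge (by positivity)
          ((div_le_one (by positivity)).2 hm) (by linarith)
      _ ≤ _ := by gcongr
  rw [div_le_iff₀ (Real.rpow_pos_of_pos (hw i) _)]
  calc _ ≤ (1 : ℝ) := h2
    _ = (m : ℝ) ^ 2 * ((m : ℝ) ^ 2)⁻¹ := by field_simp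
    _ ≤ _ := by gcongr

theorem violating_eq_empty_iff : violating A α w = ∅ ↔ ∀ i, rho A α w i ≤ 1 + α := by
  simp [violating, Set.eq_empty_iff_forall_notMem]

/-- If `ρᵢ > 1 + α`, then `(ρᵢ - 1) / (ρᵢ + 1) ≥ α/3` and the weight grows by at least `1 + α/9`. No
weight decreases, so no `ρᵢ` increases; the maximum with `1 + α` accounts for the coordinates that
already satisfy the constraint. -/
theorem rho_descent_violating_le (hA : A.rank = n) (h0 : 0 < α) (h1 : α ≤ 1) (hw : ∀ i, 0 < w i)
    {R : ℝ} (hR : ∀ i, rho A α w i ≤ max (1 + α) R) (i : Fin m) :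
    rho A α (descent A α w (violating A α w) (stepSize m α)) i ≤
      max (1 + α) (((1 + α / 9) ^ α)⁻¹ * R) := by
  have hfac : ∀ i, i ∈ violating A α w → 1 + α / 9 ≤ descentFactor A α w (violating A α w) i := by
    intro i hi
    rw [descentFactor, if_pos hi]
    have h2 : 1 + α < rho A α w i := hi
    have h3 : α / 3 ≤ (rho A α w i - 1) / (rho A α w i + 1) := by
      rw [div_le_div_iff₀ (by norm_num) (by linarith)]
      nlinarith
    linarith
  have hle : ∀ i, 1 * w i ≤ descent A α w (violating A α w) (stepSize m α) i := fun i => by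
    rw [descent_eq h1]
    refine mul_le_mul_of_nonneg_right ?_ (hw i).le
    by_cases hi : i ∈ violating A α w
    · linarith [hfac i hi]
    · rw [descentFactor, if_neg hi]
  by_cases hi : i ∈ violating A α w
  · have h2 := rho_le_of_scale hA h0 hw one_pos (by positivity : 0 < 1 + α / 9) hle i (by
      rw [descent_eq h1]
      exact mul_le_mul_of_nonneg_right (hfac i hi) (hw i).le)
    have h3 : rho A α w i ≤ R := (le_max_iff.1 (hR i)).resolve_left (not_le.2 hi)
    rw [inv_one, one_mul] at h2
    refine h2.trans (le_max_of_le_right ?_)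
    gcongr
  · have h2 := rho_le_of_scale hA h0 hw one_pos one_pos hle i (hle i)
    rw [Real.one_rpow, inv_one, one_mul, one_mul] at h2
    exact h2.trans (le_max_of_le_left (not_lt.1 hi))

/-- `RoundParallel` terminates within `k + 1` loop tests if `ρ` is at most `R` and `k` reductions by
the factor `(1 + α/9) ^ α` bring `R` below `1 + α`. -/
theorem exists_roundRun (hA : A.rank = n) (h0 : 0 < α) (h1 : α ≤ 1) (k : ℕ) :
    ∀ (w : Fin m → ℝ) (R : ℝ), (∀ i, 0 < w i) → (∀ i, rho A α w i ≤ max (1 + α) R) →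
      ((((1 + α / 9) ^ α)⁻¹) ^ k * R ≤ 1 + α) →
      ∃ w' L, RoundRun A α w w' L ∧ L.length ≤ k + 1 ∧ (∀ i, 0 < w' i) ∧
        (∀ i, rho A α w' i ≤ 1 + α) ∧ objective A α w' ≤ objective A α w := by
  induction k with
  | zero =>
    intro w R hw hR hk
    rw [pow_zero, one_mul] at hk
    rw [max_eq_left hk] at hR
    exact ⟨w, _, .done w (violating_eq_empty_iff.2 hR), by simp, hw, hR, le_rfl⟩
  | succ k ih =>
    intro w R hw hR hk
    by_cases hv : violating A α w = ∅
    · exact ⟨w, _, .done w hv, by simp, hw, violating_eq_empty_iff.1 hv, le_rfl⟩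
    · obtain ⟨w', L, hrun, hlen, hpos, hρ, hobj⟩ := ih _ _ (descent_pos h1 hw _)
        (rho_descent_violating_le hA h0 h1 hw hR) (by rwa [← mul_assoc, ← pow_succ])
      exact ⟨w', _, .step w w' L hv hrun, by simpa using hlen, hpos, hρ,
        hobj.trans (objective_descent_le_self hA h0 h1 hw _)⟩

/-- `RoundParallel` performs at most `10 α⁻² log R + 2` loop tests if `ρ ≤ R`. -/
theorem exists_roundRun_of_rho_le (hA : A.rank = n) (h0 : 0 < α) (h1 : α ≤ 1)
    (hw : ∀ i, 0 < w i) {R : ℝ} (hR1 : 1 ≤ R) (hR : ∀ i, rho A α w i ≤ R) :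
    ∃ w' L, RoundRun A α w w' L ∧ (L.length : ℝ) ≤ 10 / α ^ 2 * Real.log R + 2 ∧
      (∀ i, 0 < w' i) ∧ (∀ i, rho A α w' i ≤ 1 + α) ∧
      objective A α w' ≤ objective A α w := by
  have hlogR := Real.log_nonneg hR1
  set k := ⌈10 / α ^ 2 * Real.log R⌉₊ with hk
  have hk1 : 10 / α ^ 2 * Real.log R ≤ k := Nat.le_ceil _
  have hk2 : (k : ℝ) < 10 / α ^ 2 * Real.log R + 1 := Nat.ceil_lt_add_one (by positivity)
  have hb : (((1 + α / 9) ^ α)⁻¹) ^ k * R ≤ 1 + α := by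
    -- `log (1 + α/9) ≥ α / (9 + α) ≥ α/10`, so each pass lowers `log R` by at least `α²/10`.
    have hlog : α / 10 ≤ Real.log (1 + α / 9) := by
      refine le_trans ?_ (Real.one_sub_inv_le_log_of_pos (by positivity))
      have : 1 - (1 + α / 9)⁻¹ = α / (9 + α) := by field_simp; ring
      rw [this]
      gcongr
      linarith
    have h2 : Real.log R ≤ k * (α * Real.log (1 + α / 9)) := by
      calc Real.log R = 10 / α ^ 2 * Real.log R * (α * (α / 10)) := by field_simp
        _ ≤ _ := by gcongr
    have h3 : R ≤ ((1 + α / 9) ^ α) ^ k := by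
      rw [← Real.log_le_log_iff (by linarith) (by positivity), Real.log_pow,
        Real.log_rpow (by positivity)]
      exact h2
    rw [inv_pow, inv_mul_le_iff₀ (by positivity)]
    nlinarith
  obtain ⟨w', L, h⟩ := exists_roundRun hA h0 h1 k w R hw (fun i => (hR i).trans (le_max_right _ _))
    hb
  refine ⟨w', L, h.1, ?_, h.2.2⟩
  have : (L.length : ℝ) ≤ k + 1 := by exact_mod_cast h.2.1
  linarith

/-! ### The main loop -/

/-- Later iterations of the main loop start from `ρ ≤ 5` and take `O(α⁻²)` loop tests each. -/
theorem exists_loopRun_of_rho_le (hA : A.rank = n) (h0 : 0 < α) (h1 : α ≤ 1) {u : Fin m → ℝ}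
    (hu : IsFixedPoint A α u) (T : ℕ) :
    ∀ (w : Fin m → ℝ) (R : ℝ), (∀ i, 0 < w i) → 5 ≤ R → (∀ i, rho A α w i ≤ R) →
      ∃ w' w'' L L', LoopRun A α T w w' L ∧ RoundRun A α w' w'' L' ∧
        ((L ++ L').length : ℝ) ≤ 10 / α ^ 2 * Real.log R + 2 +
          T * (10 / α ^ 2 * Real.log 5 + 3) ∧
        (∀ i, 0 < w'' i) ∧
        objective A α w'' - objective A α u ≤
          (1 - α / 27) ^ T * (objective A α w - objective A α u) := by
  induction T with
  | zero =>
    intro w R hw hR1 hR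
    obtain ⟨w', L, hrun, hlen, hpos, hρ, hobj⟩ :=
      exists_roundRun_of_rho_le hA h0 h1 hw (by linarith) hR
    refine ⟨w, w', [], L, .zero w, hrun, by simpa using hlen, hpos, ?_⟩
    rw [pow_zero, one_mul]
    linarith
  | succ T ih =>
    intro w R hw hR1 hR
    obtain ⟨v, L, hrun, hlen, hpos, hρ, hobj⟩ :=
      exists_roundRun_of_rho_le hA h0 h1 hw (by linarith) hR
    -- Only the first rounding sees `R`; after a full step the bound is `5`. The summand `3` in the
    -- count is two tests beyond the logarithmic term plus the full step.
    obtain ⟨w', w'', L₁, L₂, hl, hr, hlen', hpos', hobj'⟩ := ih _ 5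
      (descent_pos h1 hpos Set.univ) le_rfl (rho_descent_univ_le hA h0 h1 hpos hρ)
    refine ⟨w', w'', _, L₂, .succ T w v w' L L₁ hrun hl, hr, ?_, hpos', hobj'.trans ?_⟩
    · rw [List.length_append] at hlen' ⊢
      simp only [List.length_append, List.length_cons]
      push_cast at hlen' ⊢
      linarith
    · have h2 := hu.gap_descent_le hA h0 h1 hpos hρ
      have h3 : 0 ≤ 1 - α / 27 := by linarith
      rw [pow_succ, mul_assoc]
      refine mul_le_mul_of_nonneg_left (h2.trans ?_) (pow_nonneg h3 T)
      exact mul_le_mul_of_nonneg_left (by linarith) h3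

end

/-! ### From a small gap to accurate weights, with explicit iteration counts. -/

section

variable {m n : ℕ} {A : Matrix (Fin m) (Fin n) ℝ} {w : Fin m → ℝ} {α : ℝ}

/-! ### Accuracy -/

/-- With `τ = αε/12`, raising `(1 ± τ)²` to a power at most `2/α` costs at most `(1 ± τ) ^ (4/α)`,
and `(4/α) τ = ε/3`. Bernoulli gives the lower bound and `exp (ε/3) ≤ 1 + ε` the upper one. -/
theorem approx_rpow {ε r x e : ℝ} (h0 : 0 < α) (h1 : α ≤ 1) (hε : 0 < ε) (hε1 : ε ≤ 1)
    (hr : 0 ≤ r) (hx : 0 ≤ x) (he : 0 < e) (he2 : e ≤ 2 / α)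
    (hlo : (1 - α * ε / 12) ^ 2 * r ≤ x) (hhi : x ≤ (1 + α * ε / 12) ^ 2 * r) :
    Approx ε (r ^ e) (x ^ e) := by
  set τ := α * ε / 12 with hτ
  have hτ0 : 0 < τ := by positivity
  have hτ1 : τ ≤ 1 / 12 := by
    have : α * ε ≤ 1 * 1 := mul_le_mul h1 hε1 hε.le zero_le_one
    rw [hτ]; linarith
  have hre := Real.rpow_nonneg hr e
  have hτα : 4 / α * τ = ε / 3 := by rw [hτ]; field_simp; norm_num
  have he4 : 2 * e ≤ 4 / α := by
    have : 4 / α = 2 * (2 / α) := by ring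
    linarith
  constructor
  · have h2 : 1 - ε ≤ ((1 - τ) ^ 2) ^ e := by
      have h3 : ((1 - τ) ^ 2 : ℝ) ^ e = (1 - τ) ^ (2 * e) := by
        rw [Real.rpow_mul (by linarith), Real.rpow_two]
      rw [h3]
      have h4 : (1 - τ) ^ (4 / α) ≤ (1 - τ) ^ (2 * e) :=
        Real.rpow_le_rpow_of_exponent_ge (by linarith) (by linarith) he4
      have h5 := one_add_mul_self_le_rpow_one_add (by linarith : -1 ≤ -τ)
        (by rw [le_div_iff₀ h0]; linarith : 1 ≤ 4 / α)
      rw [mul_neg, hτα, ← sub_eq_add_neg, ← sub_eq_add_neg] at h5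
      linarith
    calc (1 - ε) * r ^ e ≤ ((1 - τ) ^ 2) ^ e * r ^ e := mul_le_mul_of_nonneg_right h2 hre
      _ = ((1 - τ) ^ 2 * r) ^ e := (Real.mul_rpow (sq_nonneg _) hr).symm
      _ ≤ x ^ e := Real.rpow_le_rpow (mul_nonneg (sq_nonneg _) hr) hlo he.le
  · have h2 : ((1 + τ) ^ 2) ^ e ≤ 1 + ε := by
      calc ((1 + τ) ^ 2 : ℝ) ^ e = (1 + τ) ^ (2 * e) := by
            rw [Real.rpow_mul (by linarith), Real.rpow_two]
        _ ≤ (1 + τ) ^ (4 / α) := Real.rpow_le_rpow_of_exponent_le (by linarith) he4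
        _ ≤ (Real.exp τ) ^ (4 / α) := Real.rpow_le_rpow (by linarith)
            (by linarith [Real.add_one_le_exp τ]) (by positivity)
        _ = Real.exp (ε / 3) := by rw [← Real.exp_mul, mul_comm, hτα]
        _ ≤ 1 + ε := by
            have := (abs_le.1 (Real.abs_exp_sub_one_sub_id_le
              (abs_le.2 ⟨by linarith, by linarith⟩ : |ε / 3| ≤ 1))).2
            nlinarith
    calc x ^ e ≤ ((1 + τ) ^ 2 * r) ^ e := Real.rpow_le_rpow hx hhi he.le
      _ = ((1 + τ) ^ 2) ^ e * r ^ e := Real.mul_rpow (sq_nonneg _) hr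
      _ ≤ (1 + ε) * r ^ e := mul_le_mul_of_nonneg_right h2 hre

theorem tildeEps_pos {ε : ℝ} (hn : 1 ≤ n) (hnm : n ≤ m) (h0 : 0 < α) (hε : 0 < ε) :
    0 < tildeEps m n α ε := by
  have hm : (0 : ℝ) < m := by exact_mod_cast hn.trans hnm
  rw [tildeEps]
  positivity

theorem tildeEps_le {ε : ℝ} (hn : 1 ≤ n) (hnm : n ≤ m) (h0 : 0 < α) (h1 : α ≤ 1) (hε : 0 < ε)
    (hε1 : ε ≤ 1) : tildeEps m n α ε ≤ (α * ε / 12) ^ 2 := by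
  have hm : (1 : ℝ) ≤ m := by exact_mod_cast hn.trans hnm
  have hn' : (1 : ℝ) ≤ n := by exact_mod_cast hn
  have hD : (25 : ℝ) ^ 4 ≤ (25 * m * (√n + α) * (α + α⁻¹)) ^ 4 := by
    refine pow_le_pow_left₀ (by norm_num) ?_ 4
    have h2 : 1 ≤ √(n : ℝ) + α := by
      have := Real.one_le_sqrt.2 hn'
      linarith
    have h3 : 1 ≤ α + α⁻¹ := by
      have := (one_le_inv₀ h0).2 h1
      linarith
    calc (25 : ℝ) = 25 * 1 * 1 * 1 := by norm_num
      _ ≤ _ := by gcongr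
  calc tildeEps m n α ε ≤ α ^ 8 * ε ^ 4 / 25 ^ 4 := by
        rw [tildeEps]
        gcongr
    _ ≤ α ^ 2 * ε ^ 2 / 25 ^ 4 := by
        have h4 := pow_le_pow_of_le_one h0.le h1 (by norm_num : 2 ≤ 8)
        have h5 := pow_le_pow_of_le_one hε.le hε1 (by norm_num : 2 ≤ 4)
        gcongr
    _ ≤ _ := by
        have : 0 ≤ α ^ 2 * ε ^ 2 := by positivity
        rw [div_pow, mul_pow]
        gcongr
        norm_num

theorem four_le_mul_div {p ε : ℝ} (hm : 1 ≤ m) (hp : 4 ≤ p) (hε : 0 < ε) (hε1 : ε ≤ 1) :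
    4 ≤ m * p / ε := by
  have hm' : (1 : ℝ) ≤ m := by exact_mod_cast hm
  rw [le_div_iff₀ hε]
  nlinarith

theorem one_le_log_mul_div {p ε : ℝ} (hm : 1 ≤ m) (hp : 4 ≤ p) (hε : 0 < ε) (hε1 : ε ≤ 1) :
    1 ≤ Real.log (m * p / ε) := by
  rw [Real.le_log_iff_exp_le (by linarith [four_le_mul_div hm hp hε hε1])]
  have := Real.exp_one_lt_d9
  linarith [four_le_mul_div hm hp hε hε1]

theorem inv_alpha_le {p : ℝ} (hp : 4 ≤ p) : (alpha p)⁻¹ ≤ p := by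
  rw [alpha, inv_div]
  linarith

theorem log_div_tildeEps_le {p ε : ℝ} (hn : 1 ≤ n) (hnm : n ≤ m) (hp : 4 ≤ p) (hε : 0 < ε)
    (hε1 : ε ≤ 1) :
    Real.log (m / tildeEps m n (alpha p) ε) ≤ 45 * Real.log (m * p / ε) := by
  have hm : (1 : ℝ) ≤ m := by exact_mod_cast hn.trans hnm
  have h0 := alpha_pos hp
  have h1 := alpha_le_one hp
  have hX4 := four_le_mul_div (hn.trans hnm) hp hε hε1
  have hpos := tildeEps_pos hn hnm h0 hε
  set X := m * p / ε with hX
  have hmX : (m : ℝ) ≤ X := by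
    rw [hX, le_div_iff₀ hε]; nlinarith
  have hpX : p ≤ X := by
    rw [hX, le_div_iff₀ hε]; nlinarith
  have hεX : ε⁻¹ ≤ X := by
    rw [hX, div_eq_mul_inv]
    exact le_mul_of_one_le_left (by positivity) (by nlinarith)
  have hαX : (alpha p)⁻¹ ≤ X := (inv_alpha_le hp).trans hpX
  have h25 : (25 : ℝ) ≤ X ^ 3 := by
    calc (25 : ℝ) ≤ 4 ^ 3 := by norm_num
      _ ≤ X ^ 3 := by gcongr
  have hsX : √(n : ℝ) + alpha p ≤ X ^ 2 := by
    have hnm' : (n : ℝ) ≤ m := by exact_mod_cast hnm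
    have h2 : √(n : ℝ) ≤ n := by
      have : (1 : ℝ) ≤ n := by exact_mod_cast hn
      rw [Real.sqrt_le_left (by positivity)]
      nlinarith
    nlinarith
  have haX : alpha p + (alpha p)⁻¹ ≤ X ^ 2 := by nlinarith
  rw [← Nat.cast_ofNat, ← Real.log_pow]
  refine Real.log_le_log (by positivity) ?_
  have h2 : m / tildeEps m n (alpha p) ε = m * (25 * m * (√n + alpha p) *
      (alpha p + (alpha p)⁻¹)) ^ 4 * ((alpha p)⁻¹ ^ 8 * ε⁻¹ ^ 4) := by
    rw [tildeEps]
    field_simp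
  rw [h2]
  -- Every factor is bounded by a power of `X = mp/ε ≥ 4`; the exponents add up to `1 + 4·8 + 12 =
  -- 45`.
  calc _ ≤ X * (X ^ 3 * X * X ^ 2 * X ^ 2) ^ 4 * (X ^ 8 * X ^ 4) := by gcongr
    _ = X ^ 45 := by ring

theorem totalSteps_le {p ε : ℝ} (hn : 1 ≤ n) (hnm : n ≤ m) (hp : 4 ≤ p) (hε : 0 < ε)
    (hε1 : ε ≤ 1) : (totalSteps 27 m n p ε : ℝ) ≤ 1300 * (p * Real.log (m * p / ε)) := by
  have h0 := alpha_pos hp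
  have h1 := alpha_le_one hp
  have hlog := log_div_tildeEps_le hn hnm hp hε hε1
  have hl1 := one_le_log_mul_div (hn.trans hnm) hp hε hε1
  set l := Real.log (m * p / ε)
  have hmax : max (alpha p)⁻¹ (alpha p) = (alpha p)⁻¹ :=
    max_eq_left (h1.trans ((one_le_inv₀ h0).2 h1))
  have hb : ((27 : ℕ) : ℝ) * max (alpha p)⁻¹ (alpha p) * Real.log (m / tildeEps m n (alpha p) ε) ≤
      27 * p * (45 * l) := by
    rw [hmax]
    push_cast
    have h2 : 0 ≤ (alpha p)⁻¹ := by positivity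
    have h3 := inv_alpha_le hp
    calc 27 * (alpha p)⁻¹ * Real.log (m / tildeEps m n (alpha p) ε)
        ≤ 27 * (alpha p)⁻¹ * (45 * l) := by gcongr
      _ ≤ 27 * p * (45 * l) := by gcongr
  have h3 := Nat.ceil_le_ceil hb
  have h4 := Nat.ceil_lt_add_one (by positivity : 0 ≤ 27 * p * (45 * l))
  have h5 : (totalSteps 27 m n p ε : ℝ) ≤ ⌈27 * p * (45 * l)⌉₊ := by exact_mod_cast h3
  nlinarith

/-- The constant `κ = 27` matches the contraction `1 - α/27 ≤ exp (-α/27)`, and `m` bounds the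
initial gap. -/
theorem pow_totalSteps_mul_le {p ε : ℝ} (hn : 1 ≤ n) (hnm : n ≤ m) (hp : 4 ≤ p) (hε : 0 < ε) :
    (1 - alpha p / 27) ^ totalSteps 27 m n p ε * m ≤ tildeEps m n (alpha p) ε := by
  have hm : (0 : ℝ) < m := by exact_mod_cast hn.trans hnm
  have h0 := alpha_pos hp
  have h1 := alpha_le_one hp
  have hpos := tildeEps_pos hn hnm h0 hε
  have hT : ((27 : ℕ) : ℝ) * max (alpha p)⁻¹ (alpha p) *
      Real.log (m / tildeEps m n (alpha p) ε) ≤ totalSteps 27 m n p ε := Nat.le_ceil _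
  rw [max_eq_left (h1.trans ((one_le_inv₀ h0).2 h1))] at hT
  push_cast at hT
  set T := totalSteps 27 m n p ε
  have h2 : (1 - alpha p / 27) ^ T ≤ Real.exp (-Real.log (m / tildeEps m n (alpha p) ε)) := by
    calc (1 - alpha p / 27) ^ T ≤ Real.exp (-(alpha p / 27)) ^ T :=
          pow_le_pow_left₀ (by linarith) (by linarith [Real.add_one_le_exp (-(alpha p / 27))]) T
      _ = Real.exp (-(alpha p / 27 * T)) := by rw [← Real.exp_nat_mul]; ring_nf
      _ ≤ _ := by
          refine Real.exp_le_exp.2 (neg_le_neg ?_)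
          calc Real.log (m / tildeEps m n (alpha p) ε) = alpha p / 27 *
              (27 * (alpha p)⁻¹ * Real.log (m / tildeEps m n (alpha p) ε)) := by field_simp
            _ ≤ _ := by gcongr
  rw [Real.exp_neg, Real.exp_log (by positivity), inv_div] at h2
  calc _ ≤ tildeEps m n (alpha p) ε / m * m := by gcongr
    _ = _ := by rw [div_mul_cancel₀ _ hm.ne']

/-- The algorithm terminates within `O(p³ log (m p / ε))` leverage score computations, and its
output approximates the fixed point and its power, the Lewis weights. -/
theorem exists_accurate_run {p ε : ℝ} (hn : 1 ≤ n) (hnm : n ≤ m) (hA : A.rank = n) (hp : 4 ≤ p)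
    (hε : 0 < ε) (hε1 : ε ≤ 1) :
    ∃ wT wR L₁ L₂, LoopRun A (alpha p) (totalSteps 27 m n p ε) (fun _ => (n : ℝ) / m) wT L₁ ∧
      RoundRun A (alpha p) wT wR L₂ ∧
      ((L₁ ++ L₂).length : ℝ) ≤ 60000 * (p ^ 3 * Real.log (m * p / ε)) ∧
      ∀ u, IsFixedPoint A (alpha p) u → ∀ i,
        Approx ε (rowForm A wR i ^ (1 / alpha p)) (u i) ∧
        Approx ε ((rowForm A wR i ^ (1 / alpha p)) ^ (1 + alpha p)) (u i ^ (1 + alpha p)) := by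
  have hn' : (0 : ℝ) < n := by exact_mod_cast hn
  have hm : (1 : ℝ) ≤ m := by exact_mod_cast hn.trans hnm
  have h0 := alpha_pos hp
  have h1 := alpha_le_one hp
  obtain ⟨v, hv⟩ := exists_isFixedPoint hn hnm hA h0
  obtain ⟨wT, wR, L₁, L₂, hl, hr, hlen, hpos, hgap⟩ := exists_loopRun_of_rho_le hA h0 h1 hv
    -- The uniform weights have `ρ ≤ m²`; the added `5` meets the requirement `5 ≤ R`.
    (totalSteps 27 m n p ε) (fun _ => (n : ℝ) / m) ((m : ℝ) ^ 2 + 5)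
    (fun _ => by positivity) (by nlinarith)
    (fun i => (rho_uniform_le hA hn hnm h0 h1 i).trans (by linarith))
  refine ⟨wT, wR, L₁, L₂, hl, hr, hlen.trans ?_, fun u hu i => ?_⟩
  · have hT := totalSteps_le hn hnm hp hε hε1
    have hX4 := four_le_mul_div (hn.trans hnm) hp hε hε1
    have hl1 := one_le_log_mul_div (hn.trans hnm) hp hε hε1
    have hmX : (m : ℝ) ≤ m * p / ε := by rw [le_div_iff₀ hε]; nlinarith
    have hlogR : Real.log ((m : ℝ) ^ 2 + 5) ≤ 3 * Real.log (m * p / ε) := by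
      have : (3 : ℝ) = ((3 : ℕ) : ℝ) := by norm_num
      rw [this, ← Real.log_pow]
      refine Real.log_le_log (by positivity) ?_
      nlinarith [mul_le_mul hmX hmX (by positivity) (by positivity)]
    have hlogR0 : 0 ≤ Real.log ((m : ℝ) ^ 2 + 5) := Real.log_nonneg (by nlinarith)
    have hlog5 : Real.log 5 ≤ 4 := by
      have := Real.log_le_sub_one_of_pos (by norm_num : (0 : ℝ) < 5)
      linarith
    have hlog5' : 0 ≤ Real.log 5 := Real.log_nonneg (by norm_num)
    have hα2 : 10 / alpha p ^ 2 ≤ 10 * p ^ 2 := by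
      have := inv_alpha_le hp
      rw [div_eq_mul_inv, ← inv_pow]
      gcongr
    set l := Real.log (m * p / ε)
    calc 10 / alpha p ^ 2 * Real.log ((m : ℝ) ^ 2 + 5) + 2 +
          totalSteps 27 m n p ε * (10 / alpha p ^ 2 * Real.log 5 + 3)
        ≤ 10 * p ^ 2 * (3 * l) + 2 + 1300 * (p * l) * (10 * p ^ 2 * 4 + 3) := by gcongr
      _ ≤ _ := by
        have h2 : p ^ 2 * l ≤ p ^ 3 * l := by
          gcongr <;> linarith
        have h3 : p * l ≤ p ^ 3 * l := by
          have : p ≤ p ^ 3 := le_self_pow₀ (by linarith) (by norm_num)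
          gcongr
        have h4 : 1 ≤ p ^ 3 * l := by nlinarith
        nlinarith
  · have hg := (hu.unique hv h0) ▸ hgap
    have hgap' : objective A (alpha p) wR - objective A (alpha p) u ≤ (alpha p * ε / 12) ^ 2 := by
      refine hg.trans (le_trans ?_ ((pow_totalSteps_mul_le hn hnm hp hε).trans
        (tildeEps_le hn hnm h0 h1 hε hε1)))
      exact mul_le_mul_of_nonneg_left (hu.initial_gap_le hA hn hnm h0)
        (pow_nonneg (by linarith) _)
    have hτ1 : alpha p * ε / 12 ≤ 1 := by
      have : alpha p * ε ≤ 1 * 1 := mul_le_mul h1 hε1 hε.le zero_le_one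
      linarith
    have ha := hu.rowForm_approx h0 (fun i => (hpos i).le) (gram_posDef hA hpos) (by positivity)
      hτ1 hgap' i
    have hr0 := rowForm_nonneg A (fun i => (hpos i).le) i
    have hui := hu.nonneg i
    have h2 := approx_rpow (e := 1 / alpha p) h0 h1 hε hε1 hr0 (Real.rpow_nonneg hui _)
      (by positivity) (by gcongr; norm_num) ha.1 ha.2
    -- The power of the output is treated directly as a power of the quadratic form, with exponent
    -- `(1 + α)/α ≤ 2/α`; going through `h2` would lose accuracy.
    have h3 := approx_rpow (e := 1 / alpha p * (1 + alpha p)) h0 h1 hε hε1 hr0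
      (Real.rpow_nonneg hui _) (by positivity)
      (by rw [one_div_mul_eq_div]; gcongr; linarith) ha.1 ha.2
    have h4 : (u i ^ alpha p) ^ (1 / alpha p) = u i := by
      rw [← Real.rpow_mul hui, mul_one_div_cancel h0.ne', Real.rpow_one]
    rw [Real.rpow_mul hr0, Real.rpow_mul (Real.rpow_nonneg hui _), h4] at h3
    rw [h4] at h2
    exact ⟨h2, h3⟩

end

/-! ### Executions with bounded cost -/

theorem Instr.cost_le_one {R : Type} (i : Instr R) : i.cost ≤ 1 := by
  cases i <;> simp [Instr.cost]

section Machine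

variable {R : Type} [Fintype R]

/-- `c` leads from `s` to `s'` with work at most `W` and depth at most `D`. -/
def Within (c : Cmd R) (s s' : R → ℝ) (W D : ℕ) : Prop :=
  ∃ w t, Exec c s s' w t ∧ w ≤ W ∧ t ≤ D

theorem Within.mono {c : Cmd R} {s s' : R → ℝ} {W D W' D' : ℕ} (h : Within c s s' W D)
    (hW : W ≤ W') (hD : D ≤ D') : Within c s s' W' D' := by
  obtain ⟨w, t, he, hw, ht⟩ := h
  exact ⟨w, t, he, hw.trans hW, ht.trans hD⟩

theorem Within.seq {c d : Cmd R} {s s' s'' : R → ℝ} {W D W' D' : ℕ} (h : Within c s s' W D)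
    (h' : Within d s' s'' W' D') : Within (.seq c d) s s'' (W + W') (D + D') := by
  obtain ⟨w, t, he, hw, ht⟩ := h
  obtain ⟨w', t', he', hw', ht'⟩ := h'
  exact ⟨_, _, .seq _ _ _ _ _ _ _ _ _ he he', by omega, by omega⟩

theorem Within.loop_exit {x y : R} {c : Cmd R} {s : R → ℝ} (h : ¬ s x < s y) :
    Within (.loop x y c) s s 1 1 :=
  ⟨1, 1, .loop_exit _ _ _ _ h, le_rfl, le_rfl⟩

theorem Within.loop_enter {x y : R} {c : Cmd R} {s s' s'' : R → ℝ} {W D W' D' : ℕ}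
    (hxy : s x < s y) (h : Within c s s' W D) (h' : Within (.loop x y c) s' s'' W' D') :
    Within (.loop x y c) s s'' (1 + W + W') (1 + D + D') := by
  obtain ⟨w, t, he, hw, ht⟩ := h
  obtain ⟨w', t', he', hw', ht'⟩ := h'
  exact ⟨_, _, .loop_enter _ _ _ _ _ _ _ _ _ _ hxy he he', by omega, by omega⟩

/-- Every register copies itself: no work, but one unit of depth. -/
theorem Within.skip (s : R → ℝ) : Within (.step Instr.copy) s s 0 1 :=
  ⟨_, _, .step Instr.copy s, by simp [Instr.cost], le_rfl⟩

/-- The registers `e k` receive the values of the instructions `g k`, the others are kept. -/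
def assign {K : Type} (e : K ↪ R) (g : K → Instr R) : Cmd R :=
  .step (Function.extend e g Instr.copy)

theorem within_assign {K : Type} [Fintype K] (e : K ↪ R) (g : K → Instr R) {s s' : R → ℝ}
    (h : ∀ k, s' (e k) = (g k).eval s) (h' : ∀ r, r ∉ Set.range e → s' r = s r) :
    Within (assign e g) s s' (∑ k, (g k).cost) 1 := by
  have hs : s' = fun r => (Function.extend e g Instr.copy r).eval s := by
    funext r
    by_cases hr : r ∈ Set.range e
    · obtain ⟨k, rfl⟩ := hr
      rw [e.injective.extend_apply, h]
    · rw [Function.extend_apply' _ _ _ hr, h' r hr]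
      rfl
  have hc : ∑ r, (Function.extend e g Instr.copy r).cost = ∑ k, (g k).cost := by
    refine (Fintype.sum_of_injective e e.injective _ _ (fun r hr => ?_) fun k => ?_).symm
    · rw [Function.extend_apply' _ _ _ hr]; rfl
    · rw [e.injective.extend_apply]
  rw [hs]
  exact ⟨_, _, .step _ s, hc.le, le_rfl⟩

theorem within_assign_card {K : Type} [Fintype K] (e : K ↪ R) (g : K → Instr R) {s s' : R → ℝ}
    (h : ∀ k, s' (e k) = (g k).eval s) (h' : ∀ r, r ∉ Set.range e → s' r = s r) :
    Within (assign e g) s s' (Fintype.card K) 1 := by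
  refine (within_assign e g h h').mono ?_ le_rfl
  exact (Finset.sum_le_sum fun k _ => Instr.cost_le_one (g k)).trans_eq (by simp)

theorem within_invert {k : ℕ} (e : Fin k × Fin k ↪ R) {s s' : R → ℝ}
    (h : ∀ i j, s' (e (i, j)) = (Matrix.of fun i j => s (e (i, j)))⁻¹ i j)
    (h' : ∀ r, r ∉ Set.range e → s' r = s r) :
    Within (.invert k e) s s' (k ^ 3) ((Nat.clog 2 k + 1) ^ 2) := by
  have hs : s' = Function.extend e
      (fun ij => (Matrix.of fun i j => s (e (i, j)))⁻¹ ij.1 ij.2) s := by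
    funext r
    by_cases hr : r ∈ Set.range e
    · obtain ⟨⟨i, j⟩, rfl⟩ := hr
      rw [e.injective.extend_apply, h]
    · rw [Function.extend_apply' _ _ _ hr, h' r hr]
  rw [hs]
  exact ⟨_, _, .invert k e s, le_rfl, le_rfl⟩

/-! ### Summation along a binary tree -/

/-- The array entries `t j i` with `i < 2 ^ l` receive `t j i + t j (i + 2 ^ l)`. -/
def treeLevel {J : Type} {N : ℕ} (e : J × Fin N ↪ R) (l : ℕ) : Cmd R :=
  assign e fun x => if h : (x.2 : ℕ) < 2 ^ l ∧ (x.2 : ℕ) + 2 ^ l < N then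
    .add (e x) (e (x.1, ⟨x.2 + 2 ^ l, h.2⟩)) else .copy (e x)

/-- For all `j` in parallel, the sum of the entries `t j i` with `i < 2 ^ l` is put into `t j 0`. -/
def treeSum {J : Type} {N : ℕ} (e : J × Fin N ↪ R) : ℕ → Cmd R
  | 0 => .step Instr.copy
  | l + 1 => .seq (treeLevel e l) (treeSum e l)

/-- The entry `t j k`, or zero if `k` is out of range. -/
def entry {J : Type} {N : ℕ} (e : J × Fin N ↪ R) (s : R → ℝ) (j : J) (k : ℕ) : ℝ :=
  if h : k < N then s (e (j, ⟨k, h⟩)) else 0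

theorem treeLevel_within {J : Type} [Fintype J] {N : ℕ} (e : J × Fin N ↪ R) (l : ℕ)
    (s : R → ℝ) : ∃ s', Within (treeLevel e l) s s' (Fintype.card J * 2 ^ l) 1 ∧
      (∀ j k, k < 2 ^ l → entry e s' j k = entry e s j k + entry e s j (2 ^ l + k)) ∧
      ∀ r, r ∉ Set.range e → s' r = s r := by
  set g : J × Fin N → Instr R := fun x =>
    if h : (x.2 : ℕ) < 2 ^ l ∧ (x.2 : ℕ) + 2 ^ l < N then
      .add (e x) (e (x.1, ⟨x.2 + 2 ^ l, h.2⟩)) else .copy (e x) with hg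
  have hex : ∀ x, Function.extend e (fun x => (g x).eval s) s (e x) = (g x).eval s :=
    fun x => e.injective.extend_apply _ _ _
  refine ⟨Function.extend e (fun x => (g x).eval s) s,
    (within_assign e g hex fun r hr => Function.extend_apply' _ _ _ hr).mono ?_ le_rfl, ?_,
    fun r hr => Function.extend_apply' _ _ _ hr⟩
  · have hc : ∀ x, (g x).cost ≤ if (x.2 : ℕ) < 2 ^ l then 1 else 0 := by
      intro x
      simp only [hg]
      split_ifs with h1 h2 h2
      · exact Instr.cost_le_one _
      · exact absurd h1.1 h2
      · exact Nat.zero_le _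
      · exact le_rfl
    refine (Finset.sum_le_sum fun x _ => hc x).trans ?_
    rw [Fintype.sum_prod_type]
    change ∑ _j : J, ∑ k : Fin N, (if (k : ℕ) < 2 ^ l then 1 else 0) ≤ _
    rw [Finset.sum_const, Finset.card_univ, smul_eq_mul]
    refine Nat.mul_le_mul_left _ ?_
    rw [Fin.sum_univ_eq_sum_range (fun k => if k < 2 ^ l then 1 else 0) N, Finset.sum_boole,
      Nat.cast_id]
    refine (Finset.card_le_card (t := Finset.range (2 ^ l)) fun k hk => ?_).trans_eq
      (Finset.card_range _)
    exact Finset.mem_range.2 (Finset.mem_filter.1 hk).2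
  · intro j k hk
    by_cases hN : k < N
    · rw [entry, dif_pos hN, hex, entry, dif_pos hN, entry]
      simp only [hg]
      by_cases hN2 : 2 ^ l + k < N
      · have h3 : k < 2 ^ l ∧ k + 2 ^ l < N := ⟨hk, by omega⟩
        rw [dif_pos h3, dif_pos hN2]
        simp only [Instr.eval, add_comm k]
      · have h3 : ¬ (k < 2 ^ l ∧ k + 2 ^ l < N) := fun h => hN2 (by omega)
        rw [dif_neg h3, dif_neg hN2]
        simp [Instr.eval]
    · simp only [entry, dif_neg hN, dif_neg (by omega : ¬ 2 ^ l + k < N), add_zero]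

/-- Each level folds the upper half of the current block onto the lower half. The extra unit of
depth is the empty step ending the recursion. Reading missing entries as zero avoids assuming that
`N` is a power of two. -/
theorem treeSum_within {J : Type} [Fintype J] {N : ℕ} (e : J × Fin N ↪ R) (l : ℕ) :
    ∀ s : R → ℝ, ∃ s', Within (treeSum e l) s s' (Fintype.card J * 2 ^ l) (l + 1) ∧
      (∀ j, entry e s' j 0 = ∑ k ∈ Finset.range (2 ^ l), entry e s j k) ∧
      ∀ r, r ∉ Set.range e → s' r = s r := by
  induction l with
  | zero => exact fun s => ⟨s, (Within.skip s).mono (Nat.zero_le _) (by omega), by simp, by simp⟩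
  | succ l ih =>
    intro s
    obtain ⟨s₁, h₁, hs₁, hr₁⟩ := treeLevel_within e l s
    obtain ⟨s₂, h₂, hs₂, hr₂⟩ := ih s₁
    refine ⟨s₂, (h₁.seq h₂).mono (by rw [pow_succ]; linarith) (by omega), fun j => ?_,
      fun r hr => (hr₂ r hr).trans (hr₁ r hr)⟩
    rw [hs₂, pow_succ, mul_two, Finset.sum_range_add, ← Finset.sum_add_distrib]
    exact Finset.sum_congr rfl fun k hk => hs₁ j k (Finset.mem_range.1 hk)

theorem two_pow_clog_le {N : ℕ} (hN : 0 < N) : 2 ^ Nat.clog 2 N ≤ 2 * N := by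
  rcases Nat.lt_or_ge 1 N with h | h
  · have h1 := Nat.pow_pred_clog_lt_self (b := 2) (by norm_num) h
    have h2 : 0 < Nat.clog 2 N := Nat.clog_pos (by norm_num) h
    obtain ⟨c, hc⟩ := Nat.exists_eq_succ_of_ne_zero h2.ne'
    rw [hc] at h1 ⊢
    rw [Nat.pred_succ] at h1
    rw [pow_succ]
    omega
  · have : N = 1 := by omega
    subst this
    simp

/-- Parallel sums of `N` entries take linear work and logarithmic depth. -/
theorem treeSum_clog_within {J : Type} [Fintype J] {N : ℕ} (e : J × Fin N ↪ R) (hN : 0 < N)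
    (s : R → ℝ) : ∃ s', Within (treeSum e (Nat.clog 2 N)) s s' (Fintype.card J * (2 * N))
        (Nat.clog 2 N + 1) ∧
      (∀ j, s' (e (j, ⟨0, hN⟩)) = ∑ i, s (e (j, i))) ∧ ∀ r, r ∉ Set.range e → s' r = s r := by
  obtain ⟨s', h, hs, hr⟩ := treeSum_within e (Nat.clog 2 N) s
  refine ⟨s', h.mono (Nat.mul_le_mul_left _ (two_pow_clog_le hN)) le_rfl, fun j => ?_, hr⟩
  have h1 := hs j
  rw [entry, dif_pos hN] at h1
  rw [h1]
  have h2 : ∑ i, s (e (j, i)) = ∑ i : Fin N, entry e s j i :=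
    Finset.sum_congr rfl fun i _ => by simp [entry]
  rw [h2, Fin.sum_univ_eq_sum_range (entry e s j) N]
  refine (Finset.sum_subset (Finset.range_mono (Nat.le_pow_clog (by norm_num) N)) ?_).symm
  intro k _ hk
  rw [entry, dif_neg (by simpa using hk)]

end Machine

/-! ### The concrete machine program: registers, subroutines and loops. -/

section

variable {m n : ℕ}

/-! ### Registers and stores of the program -/

/-- The scratch registers: scalars, a flag, a counter, vectors and two arrays. -/
inductive Reg (m n : ℕ) : Type
  | sc (k : Fin 16)
  | flag
  | cnt
  | w (i : Fin m)
  | q (i : Fin m)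
  | r (i : Fin m)
  | u (i : Fin m)
  | v (i : Fin m)
  | T (x : Fin m × Fin n × Fin n)
  | M (x : Fin n × Fin n)

instance : Fintype (Reg m n) := by
  classical
  exact Fintype.ofSurjective
    (Sum.elim (Sum.elim Reg.sc (fun b : Bool => if b then Reg.flag else Reg.cnt))
      (Sum.elim (Sum.elim Reg.w (Sum.elim Reg.q Reg.r))
        (Sum.elim (Sum.elim Reg.u Reg.v) (Sum.elim Reg.T Reg.M))))
    (by
      rintro (k | _ | _ | i | i | i | i | i | x | x)
      · exact ⟨.inl (.inl k), rfl⟩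
      · exact ⟨.inl (.inr true), rfl⟩
      · exact ⟨.inl (.inr false), rfl⟩
      · exact ⟨.inr (.inl (.inl i)), rfl⟩
      · exact ⟨.inr (.inl (.inr (.inl i))), rfl⟩
      · exact ⟨.inr (.inl (.inr (.inr i))), rfl⟩
      · exact ⟨.inr (.inr (.inl (.inl i))), rfl⟩
      · exact ⟨.inr (.inr (.inl (.inr i))), rfl⟩
      · exact ⟨.inr (.inr (.inr (.inl x))), rfl⟩
      · exact ⟨.inr (.inr (.inr (.inr x))), rfl⟩)

/-- All registers of the program. -/
abbrev AllReg (m n : ℕ) : Type := Input m n ⊕ Reg m n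

/-- The contents of the scratch registers. -/
structure Store (m n : ℕ) where
  sc : Fin 16 → ℝ
  flag : ℝ
  cnt : ℝ
  w : Fin m → ℝ
  q : Fin m → ℝ
  r : Fin m → ℝ
  u : Fin m → ℝ
  v : Fin m → ℝ
  T : Fin m × Fin n × Fin n → ℝ
  M : Fin n × Fin n → ℝ

/-- The contents of all registers, given the input `x`. -/
def Store.val (s : Store m n) (x : Input m n → ℝ) : AllReg m n → ℝ
  | .inl a => x a
  | .inr (.sc k) => s.sc k
  | .inr .flag => s.flag
  | .inr .cnt => s.cnt
  | .inr (.w i) => s.w i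
  | .inr (.q i) => s.q i
  | .inr (.r i) => s.r i
  | .inr (.u i) => s.u i
  | .inr (.v i) => s.v i
  | .inr (.T y) => s.T y
  | .inr (.M y) => s.M y

/-- The register of an entry of the input matrix. -/
def regA (i : Fin m) (j : Fin n) : AllReg m n := .inl (.inl (i, j))

/-- The registers of the scalars. -/
def regSc (k : Fin 16) : AllReg m n := .inr (.sc k)
/-- The register of the flag of the rounding loop. -/
def regFlag : AllReg m n := .inr .flag
/-- The register of the iteration counter. -/
def regCnt : AllReg m n := .inr .cnt
/-- The registers of `w`. -/
def regW : Fin m ↪ AllReg m n := ⟨fun i => .inr (.w i), fun _ _ h => by simpa using h⟩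
/-- The registers of the quadratic forms. -/
def regQ : Fin m ↪ AllReg m n := ⟨fun i => .inr (.q i), fun _ _ h => by simpa using h⟩
/-- The registers of the ratios `ρ`. -/
def regR : Fin m ↪ AllReg m n := ⟨fun i => .inr (.r i), fun _ _ h => by simpa using h⟩
/-- The registers of an auxiliary vector. -/
def regU : Fin m ↪ AllReg m n := ⟨fun i => .inr (.u i), fun _ _ h => by simpa using h⟩
/-- The registers of an auxiliary vector. -/
def regV : Fin m ↪ AllReg m n := ⟨fun i => .inr (.v i), fun _ _ h => by simpa using h⟩
/-- The registers of the products to be summed up. -/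
def regT : Fin m × Fin n × Fin n ↪ AllReg m n :=
  ⟨fun x => .inr (.T x), fun _ _ h => by simpa using h⟩
/-- The registers of the matrix to be inverted. -/
def regM : Fin n × Fin n ↪ AllReg m n := ⟨fun x => .inr (.M x), fun _ _ h => by simpa using h⟩

/-- A single register. -/
def single {R : Type} (r : R) : Unit ↪ R := ⟨fun _ => r, fun _ _ _ => rfl⟩

section Assignments

variable (x : Input m n → ℝ) (s : Store m n)

theorem within_setW (g : Fin m → Instr (AllReg m n)) : Within (assign regW g) (s.val x)
    ({s with w := fun i => (g i).eval (s.val x)}.val x) m 1 := by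
  refine (within_assign_card regW g (fun k => rfl) ?_).mono (by simp) le_rfl
  rintro (a | _ | _ | _ | i | _ | _ | _ | _ | _ | _) hr <;> first | rfl | exact absurd ⟨i, rfl⟩ hr

theorem within_setQ (g : Fin m → Instr (AllReg m n)) : Within (assign regQ g) (s.val x)
    ({s with q := fun i => (g i).eval (s.val x)}.val x) m 1 := by
  refine (within_assign_card regQ g (fun k => rfl) ?_).mono (by simp) le_rfl
  rintro (a | _ | _ | _ | _ | i | _ | _ | _ | _ | _) hr <;> first | rfl | exact absurd ⟨i, rfl⟩ hr

theorem within_setR (g : Fin m → Instr (AllReg m n)) : Within (assign regR g) (s.val x)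
    ({s with r := fun i => (g i).eval (s.val x)}.val x) m 1 := by
  refine (within_assign_card regR g (fun k => rfl) ?_).mono (by simp) le_rfl
  rintro (a | _ | _ | _ | _ | _ | i | _ | _ | _ | _) hr <;> first | rfl | exact absurd ⟨i, rfl⟩ hr

theorem within_setU (g : Fin m → Instr (AllReg m n)) : Within (assign regU g) (s.val x)
    ({s with u := fun i => (g i).eval (s.val x)}.val x) m 1 := by
  refine (within_assign_card regU g (fun k => rfl) ?_).mono (by simp) le_rfl
  rintro (a | _ | _ | _ | _ | _ | _ | i | _ | _ | _) hr <;> first | rfl | exact absurd ⟨i, rfl⟩ hr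

theorem within_setV (g : Fin m → Instr (AllReg m n)) : Within (assign regV g) (s.val x)
    ({s with v := fun i => (g i).eval (s.val x)}.val x) m 1 := by
  refine (within_assign_card regV g (fun k => rfl) ?_).mono (by simp) le_rfl
  rintro (a | _ | _ | _ | _ | _ | _ | _ | i | _ | _) hr <;> first | rfl | exact absurd ⟨i, rfl⟩ hr

theorem within_setT (g : Fin m × Fin n × Fin n → Instr (AllReg m n)) :
    Within (assign regT g) (s.val x)
      ({s with T := fun y => (g y).eval (s.val x)}.val x) (m * n ^ 2) 1 := by
  refine (within_assign_card regT g (fun k => rfl) ?_).mono (by simp [sq]) le_rfl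
  rintro (a | _ | _ | _ | _ | _ | _ | _ | _ | i | _) hr <;> first | rfl | exact absurd ⟨i, rfl⟩ hr

theorem within_setM (g : Fin n × Fin n → Instr (AllReg m n)) :
    Within (assign regM g) (s.val x)
      ({s with M := fun y => (g y).eval (s.val x)}.val x) (n ^ 2) 1 := by
  refine (within_assign_card regM g (fun k => rfl) ?_).mono (by simp [sq]) le_rfl
  rintro (a | _ | _ | _ | _ | _ | _ | _ | _ | _ | i) hr <;> first | rfl | exact absurd ⟨i, rfl⟩ hr

theorem within_setFlag (g : Instr (AllReg m n)) :
    Within (assign (single regFlag) fun _ => g) (s.val x)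
      ({s with flag := g.eval (s.val x)}.val x) 1 1 := by
  refine (within_assign_card _ _ (fun k => rfl) ?_).mono (by simp) le_rfl
  rintro (a | _ | _ | _ | _ | _ | _ | _ | _ | _ | _) hr <;> first | rfl | exact absurd ⟨(), rfl⟩ hr

theorem within_setCnt (g : Instr (AllReg m n)) :
    Within (assign (single regCnt) fun _ => g) (s.val x)
      ({s with cnt := g.eval (s.val x)}.val x) 1 1 := by
  refine (within_assign_card _ _ (fun k => rfl) ?_).mono (by simp) le_rfl
  rintro (a | _ | _ | _ | _ | _ | _ | _ | _ | _ | _) hr <;> first | rfl | exact absurd ⟨(), rfl⟩ hr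

theorem within_setSc (k : Fin 16) (g : Instr (AllReg m n)) :
    Within (assign (single (regSc k)) fun _ => g) (s.val x)
      ({s with sc := Function.update s.sc k (g.eval (s.val x))}.val x) 1 1 := by
  refine (within_assign_card _ _ (fun _ => ?_) ?_).mono (by simp) le_rfl
  · exact Function.update_self ..
  · rintro (a | k' | _ | _ | _ | _ | _ | _ | _ | _ | _) hr
    on_goal 2 => exact Function.update_of_ne (fun h => hr ⟨(), by rw [h]; rfl⟩) ..
    all_goals rfl

/-- Tree sums leave unspecified partial sums in the array; this puts the resulting memory back into
the form of a `Store`. -/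
theorem val_eq_of_eq_off_T {t : AllReg m n → ℝ} (h : ∀ r, r ∉ Set.range regT → t r = s.val x r) :
    t = {s with T := fun y => t (regT y)}.val x := by
  funext r
  rcases r with a | _ | _ | _ | _ | _ | _ | _ | _ | y | _
  on_goal 10 => rfl
  all_goals exact h _ (by rintro ⟨y, hy⟩; cases hy)

theorem val_eq_of_eq_off_U {t : AllReg m n → ℝ} (h : ∀ r, r ∉ Set.range regU → t r = s.val x r) :
    t = {s with u := fun y => t (regU y)}.val x := by
  funext r
  rcases r with a | _ | _ | _ | _ | _ | _ | y | _ | _ | _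
  on_goal 8 => rfl
  all_goals exact h _ (by rintro ⟨y, hy⟩; cases hy)

theorem within_invertM : Within (.invert n regM) (s.val x)
    ({s with M := fun y => (Matrix.of fun j k => s.M (j, k))⁻¹ y.1 y.2}.val x) (n ^ 3)
      ((Nat.clog 2 n + 1) ^ 2) := by
  refine within_invert regM (fun i j => rfl) ?_
  rintro (a | _ | _ | _ | _ | _ | _ | _ | _ | _ | i) hr <;> first | rfl | exact absurd ⟨i, rfl⟩ hr

end Assignments

/-! ### Sums over the arrays -/

/-- The array of products, as a family of sums over the first index. -/
def regTFirst : (Fin n × Fin n) × Fin m ↪ AllReg m n :=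
  ⟨fun y => regT (y.2, y.1), fun y z h => by
    have := regT.injective h
    simp only [Prod.mk.injEq] at this
    exact Prod.ext this.2 this.1⟩

/-- The array of products, as a family of sums over the other two indices. -/
def regTLast : Fin m × Fin (n * n) ↪ AllReg m n :=
  ⟨fun y => regT (y.1, finProdFinEquiv.symm y.2), fun y z h => by
    have := regT.injective h
    simp only [Prod.mk.injEq, EmbeddingLike.apply_eq_iff_eq] at this
    exact Prod.ext this.1 this.2⟩

/-- An auxiliary vector, as a single sum. -/
def regUSum : Unit × Fin m ↪ AllReg m n :=
  ⟨fun y => regU y.2, fun _ _ h => Prod.ext rfl (regU.injective h)⟩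

theorem sumFirst_within (x : Input m n → ℝ) (s : Store m n) (hm : 0 < m) :
    ∃ T, Within (treeSum regTFirst (Nat.clog 2 m)) (s.val x) ({s with T := T}.val x)
      (n ^ 2 * (2 * m)) (Nat.clog 2 m + 1) ∧ ∀ y, T (⟨0, hm⟩, y) = ∑ i, s.T (i, y) := by
  obtain ⟨t, h, hs, hr⟩ := treeSum_clog_within regTFirst hm (s.val x)
  have ht := val_eq_of_eq_off_T x s (t := t) fun r hn => hr r fun ⟨y, hy⟩ => hn ⟨_, hy⟩
  refine ⟨fun y => t (regT y), ?_, fun y => hs y⟩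
  rw [← ht]
  exact h.mono (by simp [sq]) le_rfl

theorem sumLast_within (x : Input m n → ℝ) (s : Store m n) (hn : 0 < n * n) :
    ∃ T, Within (treeSum regTLast (Nat.clog 2 (n * n))) (s.val x) ({s with T := T}.val x)
      (m * (2 * (n * n))) (Nat.clog 2 (n * n) + 1) ∧
      ∀ i, T (i, finProdFinEquiv.symm ⟨0, hn⟩) = ∑ y, s.T (i, y) := by
  obtain ⟨t, h, hs, hr⟩ := treeSum_clog_within regTLast hn (s.val x)
  have ht := val_eq_of_eq_off_T x s (t := t) fun r hn => hr r fun ⟨y, hy⟩ => hn ⟨_, hy⟩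
  refine ⟨fun y => t (regT y), ?_, fun i => (hs i).trans ?_⟩
  · rw [← ht]
    exact h.mono (by simp) le_rfl
  · exact Equiv.sum_comp finProdFinEquiv.symm fun y => s.T (i, y)

theorem sumU_within (x : Input m n → ℝ) (s : Store m n) (hm : 0 < m) :
    ∃ u, Within (treeSum regUSum (Nat.clog 2 m)) (s.val x) ({s with u := u}.val x)
      (2 * m) (Nat.clog 2 m + 1) ∧ u ⟨0, hm⟩ = ∑ i, s.u i := by
  obtain ⟨t, h, hs, hr⟩ := treeSum_clog_within regUSum hm (s.val x)
  have ht := val_eq_of_eq_off_U x s (t := t) fun r hn => hr r fun ⟨y, hy⟩ => hn ⟨_, hy⟩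
  refine ⟨fun y => t (regU y), ?_, hs ()⟩
  rw [← ht]
  exact h.mono (by simp) le_rfl

/-! ### The subroutines -/

section Subroutines

variable (hm : 0 < m) (hn : 0 < n * n)

/-- Computes the quadratic forms `aᵢᵀ (Aᵀ W A)⁻¹ aᵢ`. -/
def rowFormCmd : Cmd (AllReg m n) :=
  .seq (assign regT fun y => .mul (regA y.1 y.2.1) (regW y.1)) <|
  .seq (assign regT fun y => .mul (regT y) (regA y.1 y.2.2)) <|
  .seq (treeSum regTFirst (Nat.clog 2 m)) <|
  .seq (assign regM fun y => .copy (regT (⟨0, hm⟩, y))) <|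
  .seq (.invert n regM) <|
  .seq (assign regT fun y => .mul (regA y.1 y.2.1) (regM y.2)) <|
  .seq (assign regT fun y => .mul (regT y) (regA y.1 y.2.2)) <|
  .seq (treeSum regTLast (Nat.clog 2 (n * n)))
    (assign regQ fun i => .copy (regT (i, finProdFinEquiv.symm ⟨0, hn⟩)))

theorem clog_le_of_le {k l : ℕ} (h : k ≤ l) : Nat.clog 2 k ≤ Nat.clog 2 l :=
  Nat.clog_mono_right 2 h

theorem clog_mul_self_le (hnm : n ≤ m) : Nat.clog 2 (n * n) ≤ 2 * Nat.clog 2 m := by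
  refine (Nat.clog_le_iff_le_pow (by norm_num)).2 ?_
  have h := hnm.trans (Nat.le_pow_clog (b := 2) (by norm_num) m)
  calc n * n ≤ 2 ^ Nat.clog 2 m * 2 ^ Nat.clog 2 m := Nat.mul_le_mul h h
    _ = _ := by rw [← pow_add, two_mul]

theorem rowForm_eq_sum (A : Matrix (Fin m) (Fin n) ℝ) (w : Fin m → ℝ) (i : Fin m) :
    rowForm A w i = ∑ y : Fin n × Fin n, A i y.1 * (gram A w)⁻¹ y.1 y.2 * A i y.2 := by
  rw [rowForm_eq, Fintype.sum_prod_type, dotProduct]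
  simp only [mulVec, dotProduct, Finset.mul_sum, mul_assoc]

theorem rowFormCmd_within (A : Matrix (Fin m) (Fin n) ℝ) (p ε : ℝ) (hnm : n ≤ m)
    (s : Store m n) : ∃ T M, Within (rowFormCmd hm hn) (s.val (encode A p ε))
      ({s with T := T, M := M, q := rowForm A s.w}.val (encode A p ε))
      (12 * (m * n ^ 2)) (12 * (Nat.clog 2 m + 1) ^ 2) := by
  set x := encode A p ε with hx
  have h1 := within_setT x s fun y => .mul (regA y.1 y.2.1) (regW y.1)
  set s₁ : Store m n := {s with T := fun y => A y.1 y.2.1 * s.w y.1} with hs₁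
  have h2 := within_setT x s₁ fun y => .mul (regT y) (regA y.1 y.2.2)
  set s₂ : Store m n := {s with T := fun y => A y.1 y.2.1 * s.w y.1 * A y.1 y.2.2} with hs₂
  obtain ⟨T₃, h3, hT₃⟩ := sumFirst_within x s₂ hm
  set s₃ : Store m n := {s with T := T₃} with hs₃
  have h4 := within_setM x s₃ fun y => .copy (regT (⟨0, hm⟩, y))
  have hM : (fun y => (Instr.copy (regT (⟨0, hm⟩, y))).eval (s₃.val x)) =
      fun y : Fin n × Fin n => gram A s.w y.1 y.2 := by
    funext y
    exact (hT₃ y).trans (gram_apply A s.w y.1 y.2).symm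
  rw [hM] at h4
  set s₄ : Store m n := {s with T := T₃, M := fun y => gram A s.w y.1 y.2} with hs₄
  have h5 := within_invertM x s₄
  set s₅ : Store m n := {s with T := T₃, M := fun y => (gram A s.w)⁻¹ y.1 y.2} with hs₅
  have h6 := within_setT x s₅ fun y => .mul (regA y.1 y.2.1) (regM y.2)
  set s₆ : Store m n := {s₅ with
    T := fun y => A y.1 y.2.1 * (gram A s.w)⁻¹ y.2.1 y.2.2} with hs₆
  have h7 := within_setT x s₆ fun y => .mul (regT y) (regA y.1 y.2.2)
  set s₇ : Store m n := {s₅ with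
    T := fun y => A y.1 y.2.1 * (gram A s.w)⁻¹ y.2.1 y.2.2 * A y.1 y.2.2} with hs₇
  obtain ⟨T₈, h8, hT₈⟩ := sumLast_within x s₇ hn
  set s₈ : Store m n := {s₅ with T := T₈} with hs₈
  have h9 := within_setQ x s₈ fun i => .copy (regT (i, finProdFinEquiv.symm ⟨0, hn⟩))
  have hq : (fun i => (Instr.copy (regT (i, finProdFinEquiv.symm ⟨0, hn⟩))).eval (s₈.val x)) =
      rowForm A s.w := by
    funext i
    exact (hT₈ i).trans (rowForm_eq_sum A s.w i).symm
  rw [hq] at h9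
  refine ⟨T₈, s₅.M, (h1.seq (h2.seq (h3.seq (h4.seq (h5.seq (h6.seq (h7.seq
    (h8.seq h9)))))))).mono ?_ ?_⟩
  -- Products and tree sums cost `8 m n²`; since `n ≤ m`, the inversion and the copies fit into the
  -- rest.
  · have h10 : n ^ 3 ≤ m * n ^ 2 := by
      rw [pow_succ, mul_comm]; exact Nat.mul_le_mul_right _ hnm
    have h11 : n ^ 2 ≤ m * n ^ 2 := Nat.le_mul_of_pos_left _ hm
    have h12 : m ≤ m * n ^ 2 := Nat.le_mul_of_pos_right _ (by rw [sq]; exact hn)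
    nlinarith
  · have h10 := clog_le_of_le hnm
    have h11 := clog_mul_self_le hnm
    have h12 : (Nat.clog 2 n + 1) ^ 2 ≤ (Nat.clog 2 m + 1) ^ 2 :=
      Nat.pow_le_pow_left (by omega) 2
    nlinarith

/-- Computes the quadratic forms, the ratios `ρ` and the number of violated constraints. -/
def evalCmd : Cmd (AllReg m n) :=
  .seq (rowFormCmd hm hn) <|
  .seq (assign regR fun i => .mul (regW i) (regQ i)) <|
  .seq (assign regU fun i => .pow (regW i) (regSc 4)) <|
  .seq (assign regR fun i => .div (regR i) (regU i)) <|
  .seq (assign regU fun i => .select (regSc 4) (regR i) (regSc 1) (regSc 0)) <|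
  .seq (treeSum regUSum (Nat.clog 2 m))
    (assign (single regFlag) fun _ => .copy (regU ⟨0, hm⟩))

/-- The scalars used throughout the computation have been set up. -/
structure HasConstants (α t : ℝ) (sc : Fin 16 → ℝ) : Prop where
  zero : sc 0 = 0
  one : sc 1 = 1
  third : sc 2 = 1 / 3
  exponent : sc 4 = 1 + α
  bound : sc 5 = t
  invAlpha : sc 8 = 1 / α

/-- The store holds the results of `evalCmd` for its current weights. -/
structure Evaluated (A : Matrix (Fin m) (Fin n) ℝ) (α : ℝ) (s : Store m n) : Prop where
  q : s.q = rowForm A s.w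
  r : s.r = rho A α s.w
  flag : 0 < s.flag ↔ violating A α s.w ≠ ∅

/-- The weights and the persistent scalars of two stores agree. -/
structure SameWeights (s s' : Store m n) : Prop where
  sc : s'.sc = s.sc
  cnt : s'.cnt = s.cnt
  w : s'.w = s.w

theorem evalCmd_within (A : Matrix (Fin m) (Fin n) ℝ) (p ε : ℝ) {α t : ℝ} (hnm : n ≤ m)
    (s : Store m n) (hs : HasConstants α t s.sc) (hw : ∀ i, 0 < s.w i) :
    ∃ s', Within (evalCmd hm hn) (s.val (encode A p ε)) (s'.val (encode A p ε))
      (20 * (m * n ^ 2)) (20 * (Nat.clog 2 m + 1) ^ 2) ∧ SameWeights s s' ∧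
      Evaluated A α s' := by
  set x := encode A p ε with hx
  obtain ⟨T, M, h1⟩ := rowFormCmd_within hm hn A p ε hnm s
  set s₁ : Store m n := {s with T := T, M := M, q := rowForm A s.w}
  have h2 := within_setR x s₁ fun i => .mul (regW i) (regQ i)
  set s₂ : Store m n := {s₁ with r := fun i => s.w i * rowForm A s.w i}
  have h3 := within_setU x s₂ fun i => .pow (regW i) (regSc 4)
  set s₃ : Store m n := {s₂ with u := fun i => s.w i ^ s.sc 4}
  have h4 := within_setR x s₃ fun i => .div (regR i) (regU i)
  have hr : (fun i => (Instr.div (regR i) (regU i)).eval (s₃.val x)) = rho A α s.w := by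
    funext i
    change s.w i * rowForm A s.w i / s.w i ^ s.sc 4 = _
    rw [hs.exponent, rho, sigma_eq A s.w (fun i => (hw i).le)]
  rw [hr] at h4
  set s₄ : Store m n := {s₃ with r := rho A α s.w}
  have h5 := within_setU x s₄ fun i => .select (regSc 4) (regR i) (regSc 1) (regSc 0)
  set s₅ : Store m n := {s₄ with
    u := fun i => if s.sc 4 < rho A α s.w i then s.sc 1 else s.sc 0}
  obtain ⟨u, h6, hu⟩ := sumU_within x s₅ hm
  set s₆ : Store m n := {s₅ with u := u}
  have h7 := within_setFlag x s₆ (.copy (regU ⟨0, hm⟩))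
  refine ⟨{s₆ with flag := u ⟨0, hm⟩}, (h1.seq (h2.seq (h3.seq (h4.seq (h5.seq
    (h6.seq h7)))))).mono ?_ ?_, ⟨rfl, rfl, rfl⟩, rfl, rfl, ?_⟩
  · have h12 : m ≤ m * n ^ 2 := Nat.le_mul_of_pos_right _ (by rw [sq]; exact hn)
    omega
  · nlinarith
  -- The flag is the number of violating coordinates.
  · change 0 < u ⟨0, hm⟩ ↔ _
    rw [hu]
    change 0 < ∑ i, (if s.sc 4 < rho A α s.w i then s.sc 1 else s.sc 0) ↔
      violating A α s.w ≠ ∅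
    rw [hs.exponent, hs.one, hs.zero, Ne, violating_eq_empty_iff, Finset.sum_boole, Nat.cast_pos,
      Finset.card_pos, Finset.filter_nonempty_iff]
    simp

/-- Puts the weights after a full descent step into the auxiliary vector. -/
def newWeightsCmd : Cmd (AllReg m n) :=
  .seq (assign regU fun i => .sub (regR i) (regSc 1)) <|
  .seq (assign regV fun i => .add (regR i) (regSc 1)) <|
  .seq (assign regU fun i => .div (regU i) (regV i)) <|
  .seq (assign regU fun i => .mul (regSc 2) (regU i)) <|
  .seq (assign regU fun i => .add (regSc 1) (regU i))
    (assign regU fun i => .mul (regW i) (regU i))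

theorem newWeightsCmd_within (x : Input m n → ℝ) (s : Store m n) {α t : ℝ}
    (hs : HasConstants α t s.sc) : ∃ v, Within newWeightsCmd (s.val x) ({s with
      u := fun i => s.w i * (1 + 1 / 3 * ((s.r i - 1) / (s.r i + 1))), v := v}.val x)
      (6 * m) 6 := by
  have h1 := within_setU x s fun i => .sub (regR i) (regSc 1)
  set s₁ : Store m n := {s with u := fun i => s.r i - s.sc 1}
  have h2 := within_setV x s₁ fun i => .add (regR i) (regSc 1)
  set s₂ : Store m n := {s₁ with v := fun i => s.r i + s.sc 1}
  have h3 := within_setU x s₂ fun i => .div (regU i) (regV i)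
  set s₃ : Store m n := {s₂ with u := fun i => (s.r i - s.sc 1) / (s.r i + s.sc 1)}
  have h4 := within_setU x s₃ fun i => .mul (regSc 2) (regU i)
  set s₄ : Store m n := {s₂ with u := fun i => s.sc 2 * ((s.r i - s.sc 1) / (s.r i + s.sc 1))}
  have h5 := within_setU x s₄ fun i => .add (regSc 1) (regU i)
  set s₅ : Store m n := {s₂ with
    u := fun i => s.sc 1 + s.sc 2 * ((s.r i - s.sc 1) / (s.r i + s.sc 1))}
  have h6 := within_setU x s₅ fun i => .mul (regW i) (regU i)
  refine ⟨s₂.v, ?_⟩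
  rw [← hs.third, ← hs.one]
  exact (h1.seq (h2.seq (h3.seq (h4.seq (h5.seq h6))))).mono (by omega) le_rfl

/-- A descent step on the violated coordinates. -/
def descentViolatingCmd : Cmd (AllReg m n) :=
  .seq newWeightsCmd (assign regW fun i => .select (regSc 4) (regR i) (regU i) (regW i))

/-- A descent step on all coordinates. -/
def descentAllCmd : Cmd (AllReg m n) :=
  .seq newWeightsCmd (assign regW fun i => .copy (regU i))

theorem descentViolatingCmd_within (A : Matrix (Fin m) (Fin n) ℝ) (x : Input m n → ℝ)
    {α t : ℝ} (h1 : α ≤ 1) (s : Store m n) (hs : HasConstants α t s.sc)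
    (he : Evaluated A α s) : ∃ s' : Store m n,
      Within descentViolatingCmd (s.val x) (s'.val x) (7 * m) 7 ∧
      s'.sc = s.sc ∧ s'.cnt = s.cnt ∧
      s'.w = descent A α s.w (violating A α s.w) (stepSize m α) := by
  obtain ⟨v, h2⟩ := newWeightsCmd_within x s hs
  have h3 := within_setW x {s with
    u := fun i => s.w i * (1 + 1 / 3 * ((s.r i - 1) / (s.r i + 1))), v := v}
    fun i => .select (regSc 4) (regR i) (regU i) (regW i)
  refine ⟨_, (h2.seq h3).mono (by omega) le_rfl, rfl, rfl, ?_⟩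
  funext i
  change (if s.sc 4 < s.r i then s.w i * (1 + 1 / 3 * ((s.r i - 1) / (s.r i + 1))) else s.w i) = _
  rw [hs.exponent, he.r]
  simp only [descent, stepSize_eq h1, violating]
  rfl

theorem descentAllCmd_within (A : Matrix (Fin m) (Fin n) ℝ) (x : Input m n → ℝ)
    {α t : ℝ} (h1 : α ≤ 1) (s : Store m n) (hs : HasConstants α t s.sc)
    (he : Evaluated A α s) : ∃ s' : Store m n,
      Within descentAllCmd (s.val x) (s'.val x) (7 * m) 7 ∧
      s'.sc = s.sc ∧ s'.cnt = s.cnt ∧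
      s'.w = descent A α s.w Set.univ (stepSize m α) := by
  obtain ⟨v, h2⟩ := newWeightsCmd_within x s hs
  have h3 := within_setW x {s with
    u := fun i => s.w i * (1 + 1 / 3 * ((s.r i - 1) / (s.r i + 1))), v := v}
    fun i => .copy (regU i)
  refine ⟨_, (h2.seq h3).mono (by omega) le_rfl, rfl, rfl, ?_⟩
  funext i
  change s.w i * (1 + 1 / 3 * ((s.r i - 1) / (s.r i + 1))) = _
  rw [he.r]
  simp only [descent, stepSize_eq h1, Set.mem_univ, if_true]

/-! ### The loops -/

/-- `RoundParallel`. -/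
def roundCmd : Cmd (AllReg m n) :=
  .seq (evalCmd hm hn) (.loop (regSc 0) regFlag (.seq descentViolatingCmd (evalCmd hm hn)))

/-- Induction on the abstract run. The invariant `Evaluated` says that the ratios and the flag
belong to the current weights, so the test and the following descent step share one evaluation. Each
entry of `L` pays for one test and one pass through the body. -/
theorem roundLoop_within (A : Matrix (Fin m) (Fin n) ℝ) (p ε : ℝ) {α t : ℝ} (h1 : α ≤ 1)
    (hnm : n ≤ m) {w w' : Fin m → ℝ} {L : List (Fin m → ℝ)} (hrun : RoundRun A α w w' L) :
    ∀ s : Store m n, HasConstants α t s.sc → Evaluated A α s → (∀ i, 0 < s.w i) → s.w = w →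
    ∃ s' : Store m n, Within (.loop (regSc 0) regFlag (.seq descentViolatingCmd (evalCmd hm hn)))
      (s.val (encode A p ε)) (s'.val (encode A p ε))
      (L.length * (30 * (m * n ^ 2))) (L.length * (30 * (Nat.clog 2 m + 1) ^ 2)) ∧
      s'.sc = s.sc ∧ s'.cnt = s.cnt ∧ s'.w = w' ∧ (∀ i, 0 < s'.w i) ∧ Evaluated A α s' := by
  have hW : m ≤ m * n ^ 2 := Nat.le_mul_of_pos_right _ (by rw [sq]; exact hn)
  have hD : 1 ≤ (Nat.clog 2 m + 1) ^ 2 := Nat.one_le_pow _ _ (by omega)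
  induction hrun with
  | done w hv =>
    intro s hs he hpos hw
    refine ⟨s, (Within.loop_exit fun h => ?_).mono (by simp; omega) (by simp; omega), rfl, rfl,
      hw, hpos, he⟩
    have h2 : s.sc 0 < s.flag := h
    rw [hs.zero, he.flag, hw] at h2
    exact h2 hv
  | step w w' L hv _ ih =>
    intro s hs he hpos hw
    obtain ⟨s₁, h2, hsc, hcnt, hw₁⟩ := descentViolatingCmd_within A (encode A p ε) h1 s hs he
    have hpos₁ : ∀ i, 0 < s₁.w i := by
      rw [hw₁]; exact descent_pos h1 hpos _
    obtain ⟨s₂, h3, hsame, he₂⟩ := evalCmd_within hm hn A p ε hnm s₁ (hsc ▸ hs) hpos₁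
    obtain ⟨s₃, h4, hsc₃, hcnt₃, hrest⟩ := ih s₂ (by rw [hsame.sc, hsc]; exact hs) he₂
      (by rw [hsame.w]; exact hpos₁) (by rw [hsame.w, hw₁, hw])
    refine ⟨s₃, (Within.loop_enter ?_ (h2.seq h3) h4).mono ?_ ?_,
      by rw [hsc₃, hsame.sc, hsc], by rw [hcnt₃, hsame.cnt, hcnt], hrest⟩
    · change s.sc 0 < s.flag
      rw [hs.zero, he.flag, hw]
      exact hv
    · rw [List.length_cons, add_mul, one_mul]
      omega
    · rw [List.length_cons, add_mul, one_mul]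
      omega

theorem roundCmd_within (A : Matrix (Fin m) (Fin n) ℝ) (p ε : ℝ) {α t : ℝ} (h1 : α ≤ 1)
    (hnm : n ≤ m) {w' : Fin m → ℝ} {L : List (Fin m → ℝ)} (s : Store m n)
    (hrun : RoundRun A α s.w w' L) (hs : HasConstants α t s.sc) (hpos : ∀ i, 0 < s.w i) :
    ∃ s' : Store m n, Within (roundCmd hm hn) (s.val (encode A p ε)) (s'.val (encode A p ε))
      ((L.length + 1) * (30 * (m * n ^ 2))) ((L.length + 1) * (30 * (Nat.clog 2 m + 1) ^ 2)) ∧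
      s'.sc = s.sc ∧ s'.cnt = s.cnt ∧ s'.w = w' ∧ (∀ i, 0 < s'.w i) ∧ Evaluated A α s' := by
  obtain ⟨s₁, h2, hsame, he⟩ := evalCmd_within hm hn A p ε hnm s hs hpos
  obtain ⟨s₂, h3, hsc, hcnt, hrest⟩ := roundLoop_within hm hn A p ε h1 hnm hrun s₁
    (by rw [hsame.sc]; exact hs) he (by rw [hsame.w]; exact hpos) hsame.w
  refine ⟨s₂, (h2.seq h3).mono ?_ ?_, hsc.trans hsame.sc, hcnt.trans hsame.cnt, hrest⟩
  · rw [add_mul, one_mul]; omega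
  · rw [add_mul, one_mul]; omega

/-- The main loop. -/
def mainLoopCmd : Cmd (AllReg m n) :=
  .loop regCnt (regSc 5) <| .seq (roundCmd hm hn) <| .seq descentAllCmd
    (assign (single regCnt) fun _ => .add regCnt (regSc 1))

/-- The counter is compared with the real number `t`: for natural `k`, `k < t` is equivalent to `k <
⌈t⌉₊`, so the program needs no rounding instruction. -/
theorem mainLoopCmd_within (A : Matrix (Fin m) (Fin n) ℝ) (p ε : ℝ) {α t : ℝ} (h1 : α ≤ 1)
    (hnm : n ≤ m) {T : ℕ} {w w' : Fin m → ℝ} {L : List (Fin m → ℝ)}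
    (hrun : LoopRun A α T w w' L) :
    ∀ (s : Store m n) (k : ℕ), HasConstants α t s.sc → (∀ i, 0 < s.w i) → s.w = w →
    s.cnt = k → k + T = ⌈t⌉₊ →
    ∃ s' : Store m n, Within (mainLoopCmd hm hn) (s.val (encode A p ε)) (s'.val (encode A p ε))
      (1 + L.length * (70 * (m * n ^ 2))) (1 + L.length * (70 * (Nat.clog 2 m + 1) ^ 2)) ∧
      s'.sc = s.sc ∧ s'.w = w' ∧ (∀ i, 0 < s'.w i) := by
  have hW : m ≤ m * n ^ 2 := Nat.le_mul_of_pos_right _ (by rw [sq]; exact hn)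
  have hD : 1 ≤ (Nat.clog 2 m + 1) ^ 2 := Nat.one_le_pow _ _ (by omega)
  induction hrun with
  | zero w =>
    intro s k hs hpos hw hk hT
    refine ⟨s, (Within.loop_exit fun h => ?_).mono (by simp) (by simp), rfl, hw, hpos⟩
    have h2 : s.cnt < s.sc 5 := h
    rw [hk, hs.bound, ← Nat.lt_ceil] at h2
    omega
  | succ T w v w' L L' hr _ ih =>
    intro s k hs hpos hw hk hT
    subst hw
    obtain ⟨s₁, h2, hsc₁, hcnt₁, hw₁, hpos₁, he₁⟩ :=
      roundCmd_within hm hn A p ε h1 hnm s hr hs hpos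
    have hs₁ : HasConstants α t s₁.sc := hsc₁ ▸ hs
    obtain ⟨s₂, h3, hsc₂, hcnt₂, hw₂⟩ := descentAllCmd_within A (encode A p ε) h1 s₁ hs₁ he₁
    have h4 := within_setCnt (encode A p ε) s₂ (.add regCnt (regSc 1))
    set s₃ : Store m n := {s₂ with cnt := s₂.cnt + s₂.sc 1} with hs₃
    have hsc₃ : s₃.sc = s.sc := hsc₂.trans hsc₁
    have hpos₃ : ∀ i, 0 < s₃.w i := by
      intro i
      change 0 < s₂.w i
      rw [hw₂]
      exact descent_pos h1 hpos₁ _ i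
    obtain ⟨s₄, h5, hsc₄, hrest⟩ := ih s₃ (k + 1) (hsc₃ ▸ hs) hpos₃
      (by change s₂.w = _; rw [hw₂, hw₁])
      (by change s₂.cnt + s₂.sc 1 = _
          rw [hcnt₂, hcnt₁, hk, hsc₂, hsc₁, hs.one]; push_cast; rfl) (by omega)
    refine ⟨s₄, (Within.loop_enter ?_ (h2.seq (h3.seq h4)) h5).mono ?_ ?_, hsc₄.trans hsc₃, hrest⟩
    · change s.cnt < s.sc 5
      rw [hk, hs.bound, ← Nat.lt_ceil]
      omega
    -- The entry `sqrtVec v` of the list pays for the initial evaluation of the rounding, the full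
    -- descent step and the counter.
    · rw [List.length_append, List.length_cons]
      nlinarith [Nat.zero_le (L.length * (m * n ^ 2))]
    · rw [List.length_append, List.length_cons]
      nlinarith [Nat.zero_le (L.length * (Nat.clog 2 m + 1) ^ 2)]

end Subroutines

end

/-! ### Scalar constants and the complete program. -/

section

variable {m n : ℕ}

/-! ### Straight-line scalar code -/

/-- Executes scalar instructions one after another. -/
def scalarCmd : List (Fin 16 × Instr (AllReg m n)) → Cmd (AllReg m n)
  | [] => .step Instr.copy
  | a :: l => .seq (assign (single (regSc a.1)) fun _ => a.2) (scalarCmd l)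

/-- The scalars after the execution of scalar instructions. -/
def scalarEval (x : Input m n → ℝ) (s : Store m n) :
    List (Fin 16 × Instr (AllReg m n)) → (Fin 16 → ℝ) → Fin 16 → ℝ
  | [], f => f
  | a :: l, f => scalarEval x s l (Function.update f a.1 (a.2.eval ({s with sc := f}.val x)))

theorem scalarCmd_within (x : Input m n → ℝ) (s : Store m n)
    (l : List (Fin 16 × Instr (AllReg m n))) : ∀ f : Fin 16 → ℝ,
    Within (scalarCmd l) ({s with sc := f}.val x) ({s with sc := scalarEval x s l f}.val x)
      l.length (l.length + 1) := by
  induction l with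
  | nil => exact fun f => Within.skip _
  | cons a l ih =>
    intro f
    exact ((within_setSc x {s with sc := f} a.1 a.2).seq (ih _)).mono
      (by rw [List.length_cons]; omega) (by rw [List.length_cons]; omega)

/-- The scalar code for `α`, `1 + α`, `1 / α` and the number of iterations. -/
def constantsCode (m n : ℕ) : List (Fin 16 × Instr (AllReg m n)) :=
  [(1, .const 1), (2, .const (1 / 3)), (14, .const 2), (10, .sub (.inl (.inr 0)) (regSc 14)),
    (3, .div (regSc 14) (regSc 10)), (4, .add (regSc 1) (regSc 3)),
    (8, .div (regSc 1) (regSc 3)), (9, .const 4), (10, .const 8),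
    (10, .pow (regSc 3) (regSc 10)), (11, .pow (.inl (.inr 1)) (regSc 9)),
    (10, .mul (regSc 10) (regSc 11)), (12, .const n), (13, .const (1 / 2)),
    (12, .pow (regSc 12) (regSc 13)), (12, .add (regSc 12) (regSc 3)),
    (13, .add (regSc 3) (regSc 8)), (12, .mul (regSc 12) (regSc 13)), (13, .const (25 * m)),
    (12, .mul (regSc 13) (regSc 12)), (12, .pow (regSc 12) (regSc 9)),
    (10, .div (regSc 10) (regSc 12)), (12, .const m), (10, .div (regSc 12) (regSc 10)),
    (10, .log (regSc 10)), (12, .const 27), (12, .mul (regSc 12) (regSc 8)),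
    (5, .mul (regSc 12) (regSc 10))]

theorem constantsCode_eval (A : Matrix (Fin m) (Fin n) ℝ) {p ε : ℝ} (hp : 4 ≤ p)
    (s : Store m n) :
    HasConstants (alpha p) ((27 : ℕ) * max (alpha p)⁻¹ (alpha p) *
      Real.log (m / tildeEps m n (alpha p) ε))
      (scalarEval (encode A p ε) s (constantsCode m n) 0) := by
  have h0 := alpha_pos hp
  have h1 := alpha_le_one hp
  have hmax : max (alpha p)⁻¹ (alpha p) = (alpha p)⁻¹ :=
    max_eq_left (h1.trans ((one_le_inv₀ h0).2 h1))
  have hp0 : encode A p ε (.inr 0) = p := rfl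
  have hp1 : encode A p ε (.inr 1) = ε := rfl
  have h4 : ∀ y : ℝ, y ^ (4 : ℝ) = y ^ 4 := fun y => by
    rw [← Real.rpow_natCast]; norm_num
  have h8 : ∀ y : ℝ, y ^ (8 : ℝ) = y ^ 8 := fun y => by
    rw [← Real.rpow_natCast]; norm_num
  have hα : 2 / (p - 2) = alpha p := rfl
  have hhalf : (n : ℝ) ^ (2 : ℝ)⁻¹ = √n := by
    rw [Real.sqrt_eq_rpow, one_div]
  constructor
  -- The code multiplies by `1/α` and never forms the maximum, which equals `α⁻¹` because `α ≤ 1`.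
  on_goal 5 => rw [hmax, tildeEps]
  all_goals
    simp [scalarEval, constantsCode, Instr.eval, Store.val, regSc, hp0, hp1, h4, h8, hhalf,
      hα, mul_assoc]

/-! ### The program -/

/-- The complete algorithm: set up the constants and the initial weights, run the main loop and the
final rounding, and compute the output and its power. -/
def lewisCmd (hm : 0 < m) (hn : 0 < n * n) : Cmd (AllReg m n) :=
  .seq (scalarCmd (constantsCode m n)) <|
  .seq (assign regW fun _ => .const ((n : ℚ) / m)) <|
  .seq (mainLoopCmd hm hn) <|
  .seq (roundCmd hm hn) <|
  .seq (assign regQ fun i => .pow (regQ i) (regSc 8))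
    (assign regU fun i => .pow (regQ i) (regSc 4))

/-- The Lewis weight program. -/
def lewisProgram (hm : 0 < m) (hn : 0 < n * n) : Program (Input m n) (Fin m ⊕ Fin m) where
  Scratch := Reg m n
  body := lewisCmd hm hn
  out := Sum.elim regQ regU

theorem RoundRun.length_pos {A : Matrix (Fin m) (Fin n) ℝ} {α : ℝ} {w w' : Fin m → ℝ}
    {L : List (Fin m → ℝ)} (h : RoundRun A α w w' L) : 0 < L.length := by
  cases h <;> simp

theorem lewisProgram_computes (hm : 0 < m) (hn : 0 < n * n) (hnm : n ≤ m)
    (A : Matrix (Fin m) (Fin n) ℝ) {p ε : ℝ} (hp : 4 ≤ p) {wT wR : Fin m → ℝ}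
    {L₁ L₂ : List (Fin m → ℝ)}
    (h₁ : LoopRun A (alpha p) (totalSteps 27 m n p ε) (fun _ => (n : ℝ) / m) wT L₁)
    (h₂ : RoundRun A (alpha p) wT wR L₂) :
    ∃ work depth, (lewisProgram hm hn).Computes (encode A p ε)
        (Sum.elim (fun i => rowForm A wR i ^ (1 / alpha p))
          fun i => (rowForm A wR i ^ (1 / alpha p)) ^ (p / (p - 2))) work depth ∧
      work ≤ (L₁ ++ L₂).length * (150 * (m * n ^ 2)) ∧
      depth ≤ (L₁ ++ L₂).length * (150 * (Nat.clog 2 m + 1) ^ 2) := by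
  have h1 := alpha_le_one hp
  have hn' : 0 < n := Nat.pos_of_mul_pos_left hn
  set x := encode A p ε with hx
  set s₀ : Store m n := ⟨0, 0, 0, 0, 0, 0, 0, 0, 0, 0⟩ with hs₀
  have hc0 : s₀.val x = Sum.elim x 0 := by
    funext r
    rcases r with a | r
    · rfl
    · cases r <;> rfl
  have e1 := scalarCmd_within x s₀ (constantsCode m n) 0
  have hconst := constantsCode_eval A (ε := ε) hp s₀
  set sc := scalarEval x s₀ (constantsCode m n) 0
  set s₁ : Store m n := {s₀ with sc := sc}
  have e2 := within_setW x s₁ fun _ => .const ((n : ℚ) / m)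
  have hw : (fun _ : Fin m => (Instr.const ((n : ℚ) / m)).eval (s₁.val x)) =
      fun _ => (n : ℝ) / m := by
    funext i
    simp [Instr.eval]
  rw [hw] at e2
  set s₂ : Store m n := {s₁ with w := fun _ => (n : ℝ) / m}
  obtain ⟨s₃, e3, hsc₃, hw₃, hpos₃⟩ := mainLoopCmd_within hm hn A p ε h1 hnm h₁ s₂ 0 hconst
    (fun i => by positivity) rfl (by simp [s₂, s₁, s₀]) (by rw [zero_add]; rfl)
  have hconst₃ := hconst
  rw [← show s₃.sc = sc from hsc₃] at hconst₃
  -- The last rounding test has left the quadratic forms of `wR` in the registers `q`, so the output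
  -- needs only powers.
  obtain ⟨s₄, e4, hsc₄, -, hw₄, -, he₄⟩ := roundCmd_within hm hn A p ε h1 hnm s₃
    (by rw [hw₃]; exact h₂) hconst₃ hpos₃
  have e5 := within_setQ x s₄ fun i => .pow (regQ i) (regSc 8)
  have hq : (fun i => (Instr.pow (regQ i) (regSc 8)).eval (s₄.val x)) =
      fun i => rowForm A wR i ^ (1 / alpha p) := by
    funext i
    change s₄.q i ^ s₄.sc 8 = _
    rw [he₄.q, hw₄, hsc₄, hconst₃.invAlpha]
  rw [hq] at e5
  set s₅ : Store m n := {s₄ with q := fun i => rowForm A wR i ^ (1 / alpha p)}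
  have e6 := within_setU x s₅ fun i => .pow (regQ i) (regSc 4)
  have hu : (fun i => (Instr.pow (regQ i) (regSc 4)).eval (s₅.val x)) =
      fun i => (rowForm A wR i ^ (1 / alpha p)) ^ (p / (p - 2)) := by
    funext i
    change (rowForm A wR i ^ (1 / alpha p)) ^ s₄.sc 4 = _
    rw [hsc₄, hconst₃.exponent, one_add_alpha hp]
  rw [hu] at e6
  obtain ⟨work, depth, hex, hwork, hdepth⟩ :=
    e1.seq (e2.seq (e3.seq (e4.seq (e5.seq e6))))
  refine ⟨work, depth, ⟨_, hc0 ▸ hex, ?_⟩, hwork.trans ?_, hdepth.trans ?_⟩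
  · rintro (i | i) <;> rfl
  · have hL := h₂.length_pos
    have hW : m ≤ m * n ^ 2 := Nat.le_mul_of_pos_right _ (by positivity)
    have hW1 : 1 ≤ m * n ^ 2 := le_trans hm hW
    rw [List.length_append]
    have : (constantsCode m n).length = 28 := rfl
    rw [this]
    nlinarith [Nat.mul_le_mul hL hW1, Nat.mul_le_mul hL (le_refl (m * n ^ 2)),
      Nat.zero_le (L₁.length * (m * n ^ 2))]
  · have hL := h₂.length_pos
    have hD : 1 ≤ (Nat.clog 2 m + 1) ^ 2 := Nat.one_le_pow _ _ (by omega)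
    rw [List.length_append]
    have : (constantsCode m n).length = 28 := rfl
    rw [this]
    nlinarith [Nat.mul_le_mul hL hD, Nat.mul_le_mul hL (le_refl ((Nat.clog 2 m + 1) ^ 2)),
      Nat.zero_le (L₁.length * (Nat.clog 2 m + 1) ^ 2)]

/-- Using `log (m + 1)` keeps the right side at least `5 log 2` when `m = 1`, so that it also
absorbs the added `1`. -/
theorem clog_add_one_le (hm : 0 < m) : ((Nat.clog 2 m : ℝ) + 1) ≤ 5 * Real.log (m + 1) := by
  have hm' : (1 : ℝ) ≤ m := by exact_mod_cast hm
  have h1 : (2 : ℝ) ^ Nat.clog 2 m ≤ 2 * m := by exact_mod_cast two_pow_clog_le hm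
  have h2 := Real.log_le_log (by positivity) h1
  rw [Real.log_pow, Real.log_mul (by norm_num) (by positivity)] at h2
  have h3 : Real.log m ≤ Real.log (m + 1) := Real.log_le_log (by positivity) (by linarith)
  have h4 : Real.log 2 ≤ Real.log (m + 1) := Real.log_le_log (by norm_num) (by linarith)
  have h5 := Real.log_two_gt_d9
  nlinarith

end

end LewisWeights

end

/-! ### The main theorem. -/

open LewisWeights in
theorem theorem1 :
    ∃ (κ : ℕ) (C : ℝ), 0 < κ ∧ 0 < C ∧
      ∀ (m n : ℕ), 1 ≤ n → n ≤ m →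
        ∃ P : Program (Input m n) (Fin m ⊕ Fin m),
          ∀ (A : Matrix (Fin m) (Fin n) ℝ) (p ε : ℝ), A.rank = n → 4 ≤ p → 0 < ε → ε ≤ 1 →
            (∃! v : Fin m → ℝ, IsLewisWeights A p v) ∧
            ((∀ i, A i ≠ 0) → ∃! u : Fin m → ℝ, IsOptimal A (alpha p) u) ∧
            ∃ (what : Fin m → ℝ) (L : List (Fin m → ℝ)) (work depth : ℕ),
              LewisRun κ A p ε what L ∧
              (∀ u : Fin m → ℝ, IsOptimal A (alpha p) u → ∀ i, Approx ε (what i) (u i)) ∧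
              (∀ v : Fin m → ℝ, IsLewisWeights A p v →
                ∀ i, Approx ε (what i) (v i ^ (1 - 2 / p)) ∧
                  Approx ε (what i ^ (p / (p - 2))) (v i)) ∧
              (L.length : ℝ) ≤ C * (p ^ 3 * Real.log (m * p / ε)) ∧
              P.Computes (encode A p ε) (Sum.elim what fun i => what i ^ (p / (p - 2)))
                work depth ∧
              (work : ℝ) ≤ C * (p ^ 3 * (m * n ^ 2) * Real.log (m * p / ε)) ∧
              (depth : ℝ) ≤ C * (p ^ 3 * Real.log (m * p / ε) * Real.log (m + 1) ^ 2) := by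
  -- The largest constant needed is that of the depth, `60000 · 150 · 25 = 225000000`.
  refine ⟨27, 10 ^ 9, by norm_num, by norm_num, fun m n hn hnm => ?_⟩
  have hm : 0 < m := hn.trans hnm
  have hnn : 0 < n * n := Nat.mul_pos hn hn
  refine ⟨lewisProgram hm hnn, fun A p ε hA hp hε hε1 => ⟨existsUnique_isLewisWeights hn hnm hA hp,
    existsUnique_isOptimal hn hnm hA (alpha_pos hp), ?_⟩⟩
  obtain ⟨wT, wR, L₁, L₂, h₁, h₂, hlen, hacc⟩ := exists_accurate_run hn hnm hA hp hε hε1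
  obtain ⟨work, depth, hcomp, hwork, hdepth⟩ := lewisProgram_computes hm hnn hnm A hp h₁ h₂
  have hl := one_le_log_mul_div (m := m) hm hp hε hε1
  have hX : 0 ≤ p ^ 3 * Real.log (m * p / ε) := by positivity
  refine ⟨_, L₁ ++ L₂, work, depth, ⟨wT, wR, L₁, L₂, h₁, h₂, fun i => rfl, rfl⟩,
    fun u hu i => (hacc u (hu.isFixedPoint hA (alpha_pos hp)) i).1, fun v hv i => ?_,
    hlen.trans (by linarith), hcomp, ?_, ?_⟩
  · have h := hacc _ (hv.isFixedPoint hp) i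
    refine ⟨h.1, ?_⟩
    have h2 := h.2
    rwa [← Real.rpow_mul (hv.nonneg i), one_sub_two_div_mul hp, Real.rpow_one,
      one_add_alpha hp] at h2
  · have h3 : (work : ℝ) ≤ (L₁ ++ L₂).length * (150 * (m * n ^ 2)) := by exact_mod_cast hwork
    calc (work : ℝ) ≤ (L₁ ++ L₂).length * (150 * (m * n ^ 2)) := h3
      _ ≤ 60000 * (p ^ 3 * Real.log (m * p / ε)) * (150 * (m * n ^ 2)) := by gcongr
      _ = 9000000 * (p ^ 3 * (m * n ^ 2) * Real.log (m * p / ε)) := by ring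
      _ ≤ _ := by gcongr; norm_num
  · have h3 : (depth : ℝ) ≤ (L₁ ++ L₂).length * (150 * ((Nat.clog 2 m : ℝ) + 1) ^ 2) := by
      exact_mod_cast hdepth
    calc (depth : ℝ) ≤ (L₁ ++ L₂).length * (150 * ((Nat.clog 2 m : ℝ) + 1) ^ 2) := h3
      _ ≤ 60000 * (p ^ 3 * Real.log (m * p / ε)) * (150 * (5 * Real.log (m + 1)) ^ 2) := by
          gcongr
          exact clog_add_one_le hm
      _ = 225000000 * (p ^ 3 * Real.log (m * p / ε) * Real.log (m + 1) ^ 2) := by ring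
      _ ≤ _ := by gcongr; norm_num
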